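/- Let $k\ge 3$ and let $G$ be the infinite $k$-regular tree with vertex set $V$ and graph distance $d$; write $\mathcal N_v(t)=\{u: d(u,v)\le t\}$. Let $Q_0\neq Q_1$ be mutually absolutely continuous probability measures on $\mathbb R$ whose Kullback–Leibler divergences $\int \log\frac{dQ_1}{dQ_0}\,dQ_1$ and $\int\log\frac{dQ_0}{dQ_1}\,dQ_0$ are finite. Under $\mathbb P_v$ (source $v$) the real observations $y_u(t)$, $u\in V$, $t=0,1,2,\dots$, are independent, with $y_u(t)\sim Q_1$ if $u\in\mathcal N_v(t)$ and $y_u(t)\sim Q_0$ otherwise; put $y(t)=(y_u(t))_{u\in V}$ and $Z_{vu}(t)=\sum_{s=0}^t\log\frac{d\mathbb P_v}{d\mathbb P_u}(y(s))$, where $\frac{d\mathbb P_v}{d\mathbb P_u}(y(s))$ is the density of the law of $y(s)$ under $\mathbb P_v$ with respect to its law under $\mathbb P_u$, evaluated at $y(s)$. Let $V_n\subset V$ with $|V_n|=n$ for every $n$, and let $R_n$ be nonnegative integers with $R_n/\log n\to 0$. A sequential estimator $(D,T)$ on $V_n$ consists of a stopping time $T\in\{0,1,\dots,\infty\}$ of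 the filtration generated by $y(0),y(1),\dots$ and of $V_n$-valued estimators $D(t)$ depending on $y(0),\dots,y(t)$ only. For $\alpha\in(0,1)$ let $\Delta_G(V_n,R_n,\alpha)$ be the set of those with $\mathbb P_v(T<\infty,\,D(T)=u)\le \alpha/n$ for all $u,v\in V_n$ with $d(u,v)>R_n$, and let $$T^*(V_n,R_n,\alpha)=\inf_{(D,T)\in\Delta_G(V_n,R_n,\alpha)}\ \max_{v\in V_n}\mathbb E_v[T].$$ The MSPRT $(D_n,T_n)$ (for given $n$ and $\alpha$) is defined by $$T_v=\min\Big\{t\ge 0:\min_{u\in V_n\setminus\mathcal N_v(R_n)}Z_{vu}(t)\ge\log\tfrac n\alpha\Big\},\qquad T_n=\min_{v\in V_n}T_v,\qquad D_n(t)\in\operatorname*{argmax}_{v\in V_n}\ \min_{u\in V_n\setminus\mathcal N_v(R_n)}Z_{vu}(t),$$ with $\min\emptyset=+\infty$ and ties broken in any way that depends on $y(0),\dots,y(t)$ only. Write $g\approx_{n,\alpha}h$ if $\liminf_{\alpha\to0}\liminf_{n\to\infty}\frac{g(n,\alpha)}{h(n,\alpha)}\ge1$ and $\limsup_{\alpha\to0}\limsup_{n\to\infty}\frac{g(n,\alpha)}{h(n,\alpha)}\le1$.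 Then the MSPRT is asymptotically optimal: for all $n\ge1$ and $\alpha\in(0,1)$ an MSPRT exists and every MSPRT belongs to $\Delta_G(V_n,R_n,\alpha)$, and $$\max_{v\in V_n}\mathbb E_v[T_n]\ \approx_{n,\alpha}\ T^*(V_n,R_n,\alpha).$$ Moreover $$T^*(V_n,R_n,\alpha)\ \approx_{n,\alpha}\ \frac{\log\log n}{\log(k-1)}.$$ -/

import Mathlib

open MeasureTheory Filter Topology
open scoped ENNReal

noncomputable section

namespace Cascade

variable {V : Type*} (G : SimpleGraph V) (Q₀ Q₁ : Measure ℝ)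

/-- A full record of the public states: `ω t u` is the public state `y_u(t)`. -/
abbrev Obs (V : Type*) : Type _ := ℕ → V → ℝ

open Classical in
/-- The law of the single public state `y_u(t)` when the source is `v`: it is `Q₁` if `u` is within
distance `t` from `v` and `Q₀` otherwise. -/
def vertexLaw (v : V) (t : ℕ) (u : V) : Measure ℝ :=
  if G.dist v u ≤ t then Q₁ else Q₀

/-- The law of `y(t) = (y_u(t))_u` when the source is `v`: the states are independent over `u`. -/
def stateLaw (v : V) (t : ℕ) : Measure (V → ℝ) :=
  Measure.infinitePi (vertexLaw G Q₀ Q₁ v t)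

/-- The law `ℙ_v` of the whole process of public states when the source is `v`: the states are
independent over all vertices and all times. -/
def sourceLaw (v : V) : Measure (Obs V) :=
  Measure.infinitePi (stateLaw G Q₀ Q₁ v)

instance vertexLaw_isProbabilityMeasure [IsProbabilityMeasure Q₀] [IsProbabilityMeasure Q₁]
    (v : V) (t : ℕ) (u : V) : IsProbabilityMeasure (vertexLaw G Q₀ Q₁ v t u) := by
  unfold vertexLaw
  split_ifs <;> infer_instance

instance stateLaw_isProbabilityMeasure [IsProbabilityMeasure Q₀] [IsProbabilityMeasure Q₁]
    (v : V) (t : ℕ) : IsProbabilityMeasure (stateLaw G Q₀ Q₁ v t) := by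
  unfold stateLaw
  infer_instance

instance sourceLaw_isProbabilityMeasure [IsProbabilityMeasure Q₀] [IsProbabilityMeasure Q₁]
    (v : V) : IsProbabilityMeasure (sourceLaw G Q₀ Q₁ v) := by
  unfold sourceLaw
  infer_instance

/-- The cumulative log-likelihood ratio `Z_{vu}(t) = ∑_{s ≤ t} log (dℙ_v / dℙ_u) (y(s))`. -/
def cumLLR (v u : V) (t : ℕ) (ω : Obs V) : ℝ :=
  ∑ s ∈ Finset.range (t + 1), llr (stateLaw G Q₀ Q₁ v s) (stateLaw G Q₀ Q₁ u s) (ω s)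

/-- A sequential estimator `(D, T)` with values in the finite set `W` of candidate sources:
`T` is a stopping time (possibly infinite) of the filtration generated by the observations
`y(0), y(1), …`, and `D t` is a function of `y(0), …, y(t)`. -/
structure SequentialEstimator (W : Finset V) where
  /-- the estimate at each time -/
  D : ℕ → Obs V → V
  /-- the time at which the procedure stops -/
  T : Obs V → ℕ∞
  D_mem : ∀ t ω, D t ω ∈ W
  D_adapted : ∀ t u,
    MeasurableSet[Filtration.piLE (X := fun _ : ℕ => V → ℝ) t] {ω | D t ω = u}
  T_stopping : ∀ t : ℕ,
    MeasurableSet[Filtration.piLE (X := fun _ : ℕ => V → ℝ) t] {ω | T ω ≤ (t : ℕ∞)}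

/-- The event `D(T) = u` (which includes that the procedure stops). -/
def SequentialEstimator.outputs {W : Finset V} (E : SequentialEstimator W) (u : V) :
    Set (Obs V) :=
  {ω | ∃ t : ℕ, E.T ω = (t : ℕ∞) ∧ E.D t ω = u}

/-- The class `Δ_G(W, R, α)`: for all `u, v ∈ W` with `d(u, v) > R`, the probability of the
output `u` under the source `v` is at most `α / |W|`. -/
def admissible (W : Finset V) (R : ℕ) (α : ℝ) : Set (SequentialEstimator W) :=
  {E | ∀ u ∈ W, ∀ v ∈ W, R < G.dist u v →
    sourceLaw G Q₀ Q₁ v (E.outputs u) ≤ ENNReal.ofReal (α / (W.card : ℝ))}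

/-- The worst-case expected runtime `max_{v ∈ W} 𝔼_v[T]`. -/
def worstRuntime (W : Finset V) (T : Obs V → ℕ∞) : ℝ≥0∞ :=
  ⨆ v ∈ W, ∫⁻ ω, (T ω : ℝ≥0∞) ∂(sourceLaw G Q₀ Q₁ v)

/-- The optimal worst-case expected runtime `T^*(W, R, α)` over the class `Δ_G(W, R, α)`. -/
def optRuntime (W : Finset V) (R : ℕ) (α : ℝ) : ℝ≥0∞ :=
  ⨅ E ∈ admissible G Q₀ Q₁ W R α, worstRuntime G Q₀ Q₁ W E.T

/-- The statistic `min_{u ∈ W \ N_v(R)} Z_{vu}(t)`; a minimum over the empty set is `+∞`. -/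
def minLLR (W : Finset V) (R : ℕ) (v : V) (t : ℕ) (ω : Obs V) : EReal :=
  ⨅ u ∈ W, ⨅ _ : R < G.dist v u, (cumLLR G Q₀ Q₁ v u t ω : EReal)

/-- The first time `T_v` at which `min_{u ∈ W \ N_v(R)} Z_{vu}(t) ≥ log (|W| / α)`. -/
def msprtTimeAt (W : Finset V) (R : ℕ) (α : ℝ) (v : V) (ω : Obs V) : ℕ∞ :=
  ⨅ (t : ℕ) (_ : ((Real.log ((W.card : ℝ) / α) : ℝ) : EReal) ≤ minLLR G Q₀ Q₁ W R v t ω),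
    (t : ℕ∞)

/-- The stopping time `min_{v ∈ W} T_v` of the matrix sequential probability ratio test. -/
def msprtTime (W : Finset V) (R : ℕ) (α : ℝ) (ω : Obs V) : ℕ∞ :=
  ⨅ v ∈ W, msprtTimeAt G Q₀ Q₁ W R α v ω

/-- `E` is a matrix sequential probability ratio test: its stopping time is `min_{v ∈ W} T_v` and
its estimate at time `t` is a maximiser over `v ∈ W` of `min_{u ∈ W \ N_v(R)} Z_{vu}(t)`
(ties are broken in any non-anticipating way). -/
structure IsMSPRT (W : Finset V) (R : ℕ) (α : ℝ) (E : SequentialEstimator W) : Prop where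
  time_eq : ∀ ω, E.T ω = msprtTime G Q₀ Q₁ W R α ω
  isMax : ∀ t ω, ∀ v ∈ W, minLLR G Q₀ Q₁ W R v t ω ≤ minLLR G Q₀ Q₁ W R (E.D t ω) t ω

/-- `g ≳ h`: `liminf_{α → 0} liminf_{n → ∞} g(n, α) / h(n, α) ≥ 1`. -/
def AsympGE (g h : ℕ → ℝ → ℝ≥0∞) : Prop :=
  1 ≤ liminf (fun α : ℝ => liminf (fun n : ℕ => g n α / h n α) atTop) (𝓝[>] 0)

/-- `g ≲ h`: `limsup_{α → 0} limsup_{n → ∞} g(n, α) / h(n, α) ≤ 1`. -/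
def AsympLE (g h : ℕ → ℝ → ℝ≥0∞) : Prop :=
  limsup (fun α : ℝ => limsup (fun n : ℕ => g n α / h n α) atTop) (𝓝[>] 0) ≤ 1

/-- `g ≈ h`: both `g ≳ h` and `g ≲ h`. -/
def AsympEq (g h : ℕ → ℝ → ℝ≥0∞) : Prop :=
  AsympGE g h ∧ AsympLE g h

end Cascade

end

/-! Everything is governed by how fast evidence separating two sources accumulates. At time `t` the
laws of the states under `v` and `u ≠ v` differ on at least `(k - 1) ^ t` vertices and at most a
constant times that many, so within a factor `1 ± ε` in time evidence of order `log n` takes `log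
log n / log (k - 1)` steps.

Upper bound. By independence the Hellinger affinity is multiplicative, and it is below one for `Q₁`,
`Q₀`; hence a Chernoff bound makes `Z_{vu}(t) < c` doubly exponentially unlikely in `t` under `v`
(`sourceLaw_cumLLR_lt_le`). A union bound over at most `n` alternatives with `c = log (n / α)`
controls the MSPRT time. The test is admissible by change of measure: on the output `u` the
likelihood ratio of `u` against any `v` farther than `R` is at least `n / α`
(`IsMSPRT.mem_admissible`).

Lower bound. Fix `v, u` in `V_n` more than `2R` apart. Under `v`, an admissible estimator outputs a
vertex farther than `R` from `v` with probability at most `α`. Outputs within `R` of `v` are errors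
under `u`, of total probability at most `|ball| α / n`; moving this back to `v` costs `e ^ c` except
where `Z_{vu}(t) > c` (`sourceLaw_le_time_le`). With `c = (log n) / 2`, finiteness of the
divergences and Markov's inequality make that exception negligible for `t ≤ (1 - ε) log log n / log
(k - 1)`. The condition `R = o(log n)` keeps the ball below a small power of `n` and provides such a
`u`. -/

namespace Cascade

/-! ### Growth of spheres and balls in a regular tree. -/

section Graph

open SimpleGraph

variable {V : Type*} {G : SimpleGraph V}

/-- In a tree, a vertex has at most one neighbour that is closer to a given root. -/
lemma adj_closer_unique (hT : G.IsTree) {u w x y : V} (hx : G.Adj x w) (hy : G.Adj y w)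
    (hdx : G.dist u w = G.dist u x + 1) (hdy : G.dist u w = G.dist u y + 1) : x = y := by
  obtain ⟨p, -, hp⟩ := hT.connected.exists_path_of_dist u x
  obtain ⟨q, -, hq⟩ := hT.connected.exists_path_of_dist u y
  -- The geodesics to `x` and `y`, extended by the edge to `w`, have length `dist u w`, so both are
  -- the unique path from `u` to `w`; its penultimate vertex is then both `x` and `y`.
  have hp' : (p.concat hx).IsPath :=
    Walk.isPath_of_length_eq_dist _ (by rw [Walk.length_concat, hp, hdx])
  have hq' : (q.concat hy).IsPath :=
    Walk.isPath_of_length_eq_dist _ (by rw [Walk.length_concat, hq, hdy])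
  have h := (hT.existsUnique_path u w).unique hp' hq'
  simpa using congrArg Walk.penultimate h

variable [G.LocallyFinite]

open Classical in
/-- The sphere of radius `t` around `v` in a locally finite graph. -/
noncomputable def sphere (G : SimpleGraph V) [G.LocallyFinite] (v : V) : ℕ → Finset V
  | 0 => {v}
  | t + 1 => ((sphere G v t).biUnion fun w => G.neighborFinset w).filter
      fun w => G.dist v w = t + 1

lemma mem_sphere (hc : G.Connected) {v w : V} {t : ℕ} :
    w ∈ sphere G v t ↔ G.dist v w = t := by
  classical
  induction t generalizing w with
  | zero => rw [sphere, Finset.mem_singleton, hc.dist_eq_zero_iff]; exact eq_comm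
  | succ t ih =>
    rw [sphere, Finset.mem_filter, Finset.mem_biUnion]
    refine ⟨fun h => h.2, fun h => ⟨?_, h⟩⟩
    obtain ⟨p, hp⟩ := hc.exists_walk_length_eq_dist v w
    have hnil : ¬ p.Nil := by rw [← Walk.length_eq_zero_iff]; omega
    have hadj := p.adj_penultimate hnil
    refine ⟨p.penultimate, ih.2 ?_, by simpa using hadj⟩
    have h1 : G.dist v p.penultimate ≤ p.dropLast.length := dist_le _
    have h2 : G.dist v w ≤ G.dist v p.penultimate + 1 := by
      rw [← dist_eq_one_iff_adj.2 hadj]; exact hc.dist_triangle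
    have h3 : p.dropLast.length = p.length - 1 := by simp
    omega

/-- Away from the centre every vertex has a neighbour one step closer, leaving at most `k - 1`
outward ones. The sharp exponent is `t - 1`; one extra power makes the bound uniform down to `t =
0`. -/
lemma card_sphere_le (hc : G.Connected) {k : ℕ} (hk : 2 ≤ k) (hReg : G.IsRegularOfDegree k)
    (v : V) (t : ℕ) : (sphere G v t).card ≤ k * (k - 1) ^ t := by
  classical
  have key : ∀ t, (sphere G v (t + 1)).card ≤ k * (k - 1) ^ t := by
    intro t
    induction t with
    | zero =>
      have : sphere G v 1 ⊆ G.neighborFinset v := by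
        intro w hw
        rw [mem_sphere hc, dist_eq_one_iff_adj] at hw
        simpa using hw
      simpa [hReg.degree_eq v] using Finset.card_le_card this
    | succ t ih =>
      have hsub : sphere G v (t + 1 + 1) ⊆ (sphere G v (t + 1)).biUnion
          fun w => (G.neighborFinset w).filter fun x => G.dist v x = t + 1 + 1 := by
        intro w hw
        rw [sphere, Finset.mem_filter, Finset.mem_biUnion] at hw
        obtain ⟨⟨x, hx, hxw⟩, hd⟩ := hw
        exact Finset.mem_biUnion.2 ⟨x, hx, Finset.mem_filter.2 ⟨hxw, hd⟩⟩
      have hcard := (Finset.card_le_card hsub).trans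
        (Finset.card_biUnion_le_card_mul _ _ (k - 1) ?_)
      · calc _ ≤ _ := hcard
          _ ≤ (k * (k - 1) ^ t) * (k - 1) := Nat.mul_le_mul_right _ ih
          _ = _ := by ring
      · intro w hw
        have hw2 := hw
        rw [sphere, Finset.mem_filter, Finset.mem_biUnion] at hw2
        obtain ⟨⟨x, hx, hxw⟩, -⟩ := hw2
        have hxw' : G.Adj w x := by simpa [G.adj_comm] using hxw
        rw [mem_sphere hc] at hx
        have : (G.neighborFinset w).filter (fun x => G.dist v x = t + 1 + 1)
            ⊆ (G.neighborFinset w).erase x := by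
          intro y hy
          rw [Finset.mem_filter] at hy
          refine Finset.mem_erase.2 ⟨?_, hy.1⟩
          rintro rfl
          omega
        refine (Finset.card_le_card this).trans ?_
        rw [Finset.card_erase_of_mem (by simpa using hxw'), card_neighborFinset_eq_degree,
          hReg.degree_eq w]
  cases t with
  | zero => simp [sphere]; omega
  | succ t =>
    refine (key t).trans (Nat.mul_le_mul_left _ (Nat.pow_le_pow_right (by omega) (by omega)))

open Classical in
/-- The closed ball of radius `t` around `v` in a locally finite graph. -/
noncomputable def ballFinset (G : SimpleGraph V) [G.LocallyFinite] (v : V) (t : ℕ) : Finset V :=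
  (Finset.range (t + 1)).biUnion (sphere G v)

lemma mem_ballFinset (hc : G.Connected) {v w : V} {t : ℕ} :
    w ∈ ballFinset G v t ↔ G.dist v w ≤ t := by
  simp [ballFinset, mem_sphere hc]

lemma card_ballFinset_le (hc : G.Connected) {k : ℕ} (hk : 3 ≤ k) (hReg : G.IsRegularOfDegree k)
    (v : V) (t : ℕ) : (ballFinset G v t).card ≤ k * (k - 1) ^ (t + 1) := by
  classical
  refine Finset.card_biUnion_le.trans ?_
  refine (Finset.sum_le_sum fun s _ => card_sphere_le hc (by omega) hReg v s).trans ?_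
  rw [← Finset.mul_sum]
  exact Nat.mul_le_mul_left _ (Nat.geomSum_lt (by omega) (by simp)).le

/-- In a `k`-regular tree, seen from `v`, at least `(k - 1) ^ t` vertices of the sphere of radius
`t` lie in the branches pointing away from another vertex `u`. -/
lemma pow_le_card_away (hT : G.IsTree) {k : ℕ} (hReg : G.IsRegularOfDegree k)
    (u v : V) (t : ℕ) :
    (k - 1) ^ t ≤ ((sphere G v t).filter fun w => G.dist u w = t + G.dist u v).card := by
  classical
  have hc := hT.connected
  induction t with
  | zero => simp [sphere, Finset.filter_singleton]
  | succ t ih =>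
    set B : ℕ → Finset V := fun t => (sphere G v t).filter fun w => G.dist u w = t + G.dist u v
      with hB
    change _ ≤ (B t).card at ih
    change _ ≤ (B (t + 1)).card
    have hmem : ∀ t w, w ∈ B t ↔ G.dist v w = t ∧ G.dist u w = t + G.dist u v := by
      intro t w; simp [hB, mem_sphere hc]
    let C : V → Finset V := fun w =>
      (G.neighborFinset w).filter fun x => G.dist u x = G.dist u w + 1
    -- A step away from `u` is also a step away from `v`: by the triangle inequality through `v`,
    -- `dist u x = t + 1 + dist u v` forces `dist v x ≥ t + 1`.
    have hsub : (B t).biUnion C ⊆ B (t + 1) := by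
      intro x hx
      obtain ⟨w, hw, hx⟩ := Finset.mem_biUnion.1 hx
      obtain ⟨hadj, hd⟩ := Finset.mem_filter.1 hx
      rw [hmem] at hw ⊢
      have hadj' : G.dist w x = 1 := dist_eq_one_iff_adj.2 (by simpa using hadj)
      have h1 : G.dist v x ≤ G.dist v w + G.dist w x := hc.dist_triangle
      have h2 : G.dist u x ≤ G.dist u v + G.dist v x := hc.dist_triangle
      omega
    have hdisj : ((B t : Set V)).PairwiseDisjoint C := by
      intro w _ w' _ hne
      refine Finset.disjoint_left.2 fun x hx hx' => hne ?_
      obtain ⟨ha, hd⟩ := Finset.mem_filter.1 hx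
      obtain ⟨ha', hd'⟩ := Finset.mem_filter.1 hx'
      exact adj_closer_unique hT (by simpa using ha) (by simpa using ha') hd hd'
    -- Distances to `u` change by exactly one along a tree edge, so a neighbour outside `C w` is
    -- closer to `u`, and there is at most one of those.
    have hC : ∀ w, k - 1 ≤ (C w).card := by
      intro w
      have hsplit := Finset.card_filter_add_card_filter_not (s := G.neighborFinset w)
        (fun x => G.dist u x = G.dist u w + 1)
      have hone : ((G.neighborFinset w).filter
          fun x => ¬ G.dist u x = G.dist u w + 1).card ≤ 1 := by
        rw [Finset.card_le_one]
        intro x hx y hy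
        obtain ⟨ha, hd⟩ := Finset.mem_filter.1 hx
        obtain ⟨ha', hd'⟩ := Finset.mem_filter.1 hy
        rw [mem_neighborFinset] at ha ha'
        exact adj_closer_unique hT (u := u) ha.symm ha'.symm
          ((hT.dist_eq_dist_add_one_of_adj u ha).resolve_right hd)
          ((hT.dist_eq_dist_add_one_of_adj u ha').resolve_right hd')
      rw [card_neighborFinset_eq_degree, hReg.degree_eq w] at hsplit
      change k - 1 ≤ ((G.neighborFinset w).filter fun x => G.dist u x = G.dist u w + 1).card
      omega
    calc (k - 1) ^ (t + 1) = (k - 1) ^ t * (k - 1) := pow_succ _ _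
      _ ≤ (B t).card * (k - 1) := Nat.mul_le_mul_right _ ih
      _ = ∑ _w ∈ B t, (k - 1) := by simp
      _ ≤ ∑ w ∈ B t, (C w).card := Finset.sum_le_sum fun w _ => hC w
      _ = ((B t).biUnion C).card := (Finset.card_biUnion hdisj).symm
      _ ≤ _ := Finset.card_le_card hsub

end Graph

end Cascade

namespace Cascade

/-! ### Densities of infinite products differing in finitely many factors. -/

section ProductDensity

open Measure

variable {ι : Type*} {X : ι → Type*} [∀ i, MeasurableSpace (X i)]
  (P P' : ∀ i, Measure (X i)) [∀ i, IsProbabilityMeasure (P i)] [∀ i, IsProbabilityMeasure (P' i)]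

lemma lintegral_prod_infinitePi (S : Finset ι) (f : ∀ i, X i → ℝ≥0∞)
    (hf : ∀ i, Measurable (f i)) :
    ∫⁻ x, ∏ i ∈ S, f i (x i) ∂infinitePi P = ∏ i ∈ S, ∫⁻ x, f i x ∂P i := by
  refine (ProbabilityTheory.lintegral_prod_eq_prod_lintegral_of_indepFun S
    (fun i (x : ∀ i, X i) => f i (x i)) (ProbabilityTheory.iIndepFun_infinitePi hf)
    (fun i => (hf i).comp (measurable_pi_apply i))).trans ?_
  refine Finset.prod_congr rfl fun i _ => ?_
  exact (measurePreserving_eval_infinitePi P i).lintegral_comp (hf i)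

/-- An infinite product measure is determined by finite boxes. On a box the indicator times the
density is again a product of one-coordinate functions over `S ∪ s`, so the integral factorises. -/
lemma infinitePi_eq_withDensity (S : Finset ι) (f : ∀ i, X i → ℝ≥0∞)
    (hf : ∀ i, Measurable (f i)) (hS : ∀ i ∈ S, P i = (P' i).withDensity (f i))
    (hS' : ∀ i ∉ S, P i = P' i) :
    infinitePi P = (infinitePi P').withDensity fun x => ∏ i ∈ S, f i (x i) := by
  classical
  refine (eq_infinitePi P fun s t ht => ?_).symm
  have hpi : MeasurableSet (Set.pi (s : Set ι) t) :=
    MeasurableSet.pi s.countable_toSet fun i _ => ht i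
  let t' : ∀ i, Set (X i) := fun i => if i ∈ s then t i else Set.univ
  let f' : ∀ i, X i → ℝ≥0∞ := fun i => if i ∈ S then f i else 1
  have ht' : ∀ i, MeasurableSet (t' i) := fun i => by
    by_cases h : i ∈ s <;> simp [t', h, ht]
  have hf' : ∀ i, Measurable (f' i) := fun i => by
    by_cases h : i ∈ S <;> simp [f', h, hf, measurable_one]
  have hP : ∀ i, P i = (P' i).withDensity (f' i) := fun i => by
    by_cases h : i ∈ S
    · simp [f', h, hS i h]
    · simp [f', h, hS' i h]
  have hpt : ∀ x : ∀ i, X i, (Set.pi (s : Set ι) t).indicator (fun x => ∏ i ∈ S, f i (x i)) x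
      = ∏ i ∈ S ∪ s, (t' i).indicator (f' i) (x i) := by
    intro x
    by_cases hx : x ∈ Set.pi (s : Set ι) t
    · rw [Set.indicator_of_mem hx]
      have : ∀ i ∈ S ∪ s, (t' i).indicator (f' i) (x i) = f' i (x i) := by
        intro i _
        refine Set.indicator_of_mem ?_ _
        by_cases h : i ∈ s
        · simpa [t', h] using hx i h
        · simp [t', h]
      rw [Finset.prod_congr rfl this]
      rw [← Finset.prod_subset (Finset.subset_union_left (s₁ := S) (s₂ := s))]
      · exact Finset.prod_congr rfl fun i hi => by simp [f', hi]
      · intro i _ hi; simp [f', hi]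
    · rw [Set.indicator_of_notMem hx]
      have : ∃ i ∈ s, x i ∉ t i := by simpa [Set.mem_pi] using hx
      obtain ⟨i, hi, hxi⟩ := this
      refine (Finset.prod_eq_zero (Finset.mem_union_right S hi) ?_).symm
      exact Set.indicator_of_notMem (by simpa [t', hi] using hxi) _
  rw [withDensity_apply _ hpi, ← lintegral_indicator hpi]
  simp_rw [hpt]
  rw [lintegral_prod_infinitePi P' _ _ fun i => (hf' i).indicator (ht' i)]
  have : ∀ i, ∫⁻ x, (t' i).indicator (f' i) x ∂P' i = P i (t' i) := by
    intro i
    rw [lintegral_indicator (ht' i), ← withDensity_apply _ (ht' i), ← hP i]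
  simp_rw [this]
  rw [← Finset.prod_subset (Finset.subset_union_right (s₁ := S) (s₂ := s))]
  · exact Finset.prod_congr rfl fun i hi => by simp [t', hi]
  · intro i _ hi; simp [t', hi]

variable {P P'} {S : Finset ι}

lemma infinitePi_eq_withDensity_rnDeriv (hac : ∀ i ∈ S, P i ≪ P' i)
    (hS' : ∀ i ∉ S, P i = P' i) :
    infinitePi P = (infinitePi P').withDensity
      fun x => ∏ i ∈ S, (P i).rnDeriv (P' i) (x i) :=
  infinitePi_eq_withDensity P P' S _ (fun _ => measurable_rnDeriv _ _)
    (fun i hi => (withDensity_rnDeriv_eq _ _ (hac i hi)).symm) hS'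

lemma infinitePi_absolutelyContinuous (hac : ∀ i ∈ S, P i ≪ P' i)
    (hS' : ∀ i ∉ S, P i = P' i) : infinitePi P ≪ infinitePi P' := by
  rw [infinitePi_eq_withDensity_rnDeriv hac hS']
  exact withDensity_absolutelyContinuous _ _

/-- The log-likelihood ratio of two product measures that differ in finitely many coordinates is
the sum of the log-likelihood ratios of those coordinates. -/
lemma llr_infinitePi (hac : ∀ i ∈ S, P i ≪ P' i) (hS' : ∀ i ∉ S, P i = P' i) :
    llr (infinitePi P) (infinitePi P') =ᵐ[infinitePi P]
      fun x => ∑ i ∈ S, llr (P i) (P' i) (x i) := by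
  have h1 : (infinitePi P).rnDeriv (infinitePi P') =ᵐ[infinitePi P']
      fun x => ∏ i ∈ S, (P i).rnDeriv (P' i) (x i) := by
    conv_lhs => rw [infinitePi_eq_withDensity_rnDeriv hac hS']
    refine rnDeriv_withDensity _ ?_
    exact Finset.measurable_prod _ fun i _ =>
      (measurable_rnDeriv _ _).comp (measurable_pi_apply i)
  have h2 : ∀ᵐ x ∂infinitePi P, ∀ i ∈ S,
      0 < (P i).rnDeriv (P' i) (x i) ∧ (P i).rnDeriv (P' i) (x i) < ∞ := by
    rw [Finset.eventually_all]
    intro i hi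
    have h3 : ∀ᵐ y ∂P i, 0 < (P i).rnDeriv (P' i) y ∧ (P i).rnDeriv (P' i) y < ∞ :=
      (rnDeriv_pos (hac i hi)).and ((hac i hi).ae_le (rnDeriv_lt_top _ _))
    exact (measurePreserving_eval_infinitePi P i).quasiMeasurePreserving.ae h3
  filter_upwards [(infinitePi_absolutelyContinuous hac hS').ae_le h1, h2] with x hx hx2
  rw [llr, hx, ENNReal.toReal_prod, Real.log_prod]
  · rfl
  · intro i hi
    exact (ENNReal.toReal_pos (hx2 i hi).1.ne' (hx2 i hi).2.ne).ne'

end ProductDensity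

/-! ### Hellinger affinity and its multiplicativity. -/

section Affinity

variable {α : Type*} [MeasurableSpace α]

/-- The Hellinger affinity of two measures, as the exponential moment of order `-1/2` of the
log-likelihood ratio. -/
noncomputable def affinity (μ ν : Measure α) : ℝ≥0∞ :=
  ∫⁻ x, ENNReal.ofReal (Real.exp (-(llr μ ν x) / 2)) ∂μ

variable {μ ν : Measure α} [IsProbabilityMeasure μ] [IsProbabilityMeasure ν]

/-- Expand the square: the cross term is the affinity, and the mean of `exp (-llr)` is at most the
total mass of `ν`. Keeping the square on the left gives both the bound by one and its equality case.
-/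
lemma two_mul_affinity_add_le (hμν : μ ≪ ν) :
    2 * affinity μ ν
      + ∫⁻ x, ENNReal.ofReal ((1 - Real.exp (-(llr μ ν x) / 2)) ^ 2) ∂μ ≤ 2 := by
  have hm := measurable_llr μ ν
  have hpt : ∀ x, 2 * ENNReal.ofReal (Real.exp (-(llr μ ν x) / 2))
      + ENNReal.ofReal ((1 - Real.exp (-(llr μ ν x) / 2)) ^ 2)
      = 1 + ENNReal.ofReal (Real.exp (-(llr μ ν x))) := by
    intro x
    have h2 : Real.exp (-(llr μ ν x)) = Real.exp (-(llr μ ν x) / 2) ^ 2 := by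
      rw [← Real.exp_nat_mul]; congr 1; push_cast; ring
    rw [h2, show (2 : ℝ≥0∞) = ENNReal.ofReal 2 by simp,
      show (1 : ℝ≥0∞) = ENNReal.ofReal 1 by simp, ← ENNReal.ofReal_mul (by norm_num),
      ← ENNReal.ofReal_add (by positivity) (by positivity),
      ← ENNReal.ofReal_add (by positivity) (by positivity)]
    congr 1; ring
  have hle : ∫⁻ x, ENNReal.ofReal (Real.exp (-(llr μ ν x))) ∂μ ≤ 1 := by
    calc ∫⁻ x, ENNReal.ofReal (Real.exp (-(llr μ ν x))) ∂μ
        ≤ ∫⁻ x, ν.rnDeriv μ x ∂μ := by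
          refine lintegral_mono_ae ?_
          filter_upwards [exp_neg_llr hμν] with x hx
          rw [hx]; exact ENNReal.ofReal_toReal_le
      _ ≤ ν Set.univ := Measure.lintegral_rnDeriv_le
      _ = 1 := measure_univ
  rw [affinity, ← lintegral_const_mul _ (by fun_prop), ← lintegral_add_left (by fun_prop)]
  simp_rw [hpt]
  rw [lintegral_add_left (by fun_prop), lintegral_const, measure_univ, mul_one]
  calc 1 + _ ≤ (1 : ℝ≥0∞) + 1 := by gcongr
    _ = 2 := one_add_one_eq_two

lemma affinity_le_one (hμν : μ ≪ ν) : affinity μ ν ≤ 1 := by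
  have h := le_self_add.trans (two_mul_affinity_add_le hμν)
  have h' : 2 * affinity μ ν ≤ 2 * 1 := by simpa using h
  exact (ENNReal.mul_le_mul_iff_right (by norm_num) (by norm_num)).1 h'

/-- Affinity one makes the square vanish almost everywhere, so `dν/dμ = 1`, and `ν ≪ μ` then yields
`ν = μ`. -/
lemma affinity_lt_one (hμν : μ ≪ ν) (hνμ : ν ≪ μ) (hne : μ ≠ ν) : affinity μ ν < 1 := by
  refine lt_of_le_of_ne (affinity_le_one hμν) fun h1 => hne ?_
  have h := two_mul_affinity_add_le hμν
  rw [h1, mul_one] at h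
  have h0 : ∫⁻ x, ENNReal.ofReal ((1 - Real.exp (-(llr μ ν x) / 2)) ^ 2) ∂μ = 0 := by
    refine le_antisymm ((ENNReal.add_le_add_iff_left (a := 2) (by norm_num)).1 ?_) zero_le
    rwa [add_zero]
  have hm := measurable_llr μ ν
  rw [lintegral_eq_zero_iff (by fun_prop)] at h0
  have hd : ν.rnDeriv μ =ᵐ[μ] 1 := by
    filter_upwards [h0, exp_neg_llr hμν] with x hx hx2
    have hx3 : (1 - Real.exp (-(llr μ ν x) / 2)) ^ 2 ≤ 0 := by simpa using hx
    have hx4 : 1 - Real.exp (-(llr μ ν x) / 2) = 0 := by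
      simpa using le_antisymm hx3 (sq_nonneg _)
    have hx5 : -(llr μ ν x) / 2 = 0 := by
      rw [← Real.exp_eq_one_iff]; linarith
    have hx6 : llr μ ν x = 0 := by linarith
    rw [hx6, neg_zero, Real.exp_zero] at hx2
    simpa using ((ENNReal.toReal_eq_one_iff _).1 hx2.symm)
  rw [← Measure.withDensity_rnDeriv_eq ν μ hνμ, withDensity_congr_ae hd, withDensity_one]

end Affinity

section ProductAffinity

open Measure

variable {ι : Type*} {X : ι → Type*} [∀ i, MeasurableSpace (X i)]
  {P P' : ∀ i, Measure (X i)} [∀ i, IsProbabilityMeasure (P i)] [∀ i, IsProbabilityMeasure (P' i)]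
  {S : Finset ι}

lemma affinity_infinitePi (hac : ∀ i ∈ S, P i ≪ P' i) (hS' : ∀ i ∉ S, P i = P' i) :
    affinity (infinitePi P) (infinitePi P') = ∏ i ∈ S, affinity (P i) (P' i) := by
  unfold affinity
  rw [← lintegral_prod_infinitePi P S
    (fun i x => ENNReal.ofReal (Real.exp (-(llr (P i) (P' i) x) / 2)))
    (fun i => by have := measurable_llr (P i) (P' i); fun_prop)]
  refine lintegral_congr_ae ?_
  filter_upwards [llr_infinitePi hac hS'] with x hx
  rw [hx, ← ENNReal.ofReal_prod_of_nonneg fun i _ => (Real.exp_pos _).le, ← Real.exp_sum,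
    ← Finset.sum_div, Finset.sum_neg_distrib]

lemma lintegral_enorm_llr_infinitePi_le (hac : ∀ i ∈ S, P i ≪ P' i)
    (hS' : ∀ i ∉ S, P i = P' i) :
    ∫⁻ x, ‖llr (infinitePi P) (infinitePi P') x‖ₑ ∂infinitePi P
      ≤ ∑ i ∈ S, ∫⁻ x, ‖llr (P i) (P' i) x‖ₑ ∂P i := by
  have hm : ∀ i, Measurable fun x => ‖llr (P i) (P' i) x‖ₑ :=
    fun i => (measurable_llr _ _).enorm
  calc ∫⁻ x, ‖llr (infinitePi P) (infinitePi P') x‖ₑ ∂infinitePi P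
      ≤ ∫⁻ x, ∑ i ∈ S, ‖llr (P i) (P' i) (x i)‖ₑ ∂infinitePi P := by
        refine lintegral_mono_ae ?_
        filter_upwards [llr_infinitePi hac hS'] with x hx
        rw [hx]
        exact enorm_sum_le _ _
    _ = ∑ i ∈ S, ∫⁻ x, ‖llr (P i) (P' i) (x i)‖ₑ ∂infinitePi P :=
        lintegral_finsetSum _ fun i _ => (hm i).comp (measurable_pi_apply i)
    _ = _ := Finset.sum_congr rfl fun i _ =>
        (measurePreserving_eval_infinitePi P i).lintegral_comp (hm i)

end ProductAffinity

end Cascade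

namespace Cascade

/-! ### Comparison of two sources at a single time. -/

section States

variable {V : Type*} {G : SimpleGraph V} {Q₀ Q₁ : Measure ℝ}

lemma vertexLaw_absolutelyContinuous (h01 : Q₀ ≪ Q₁) (h10 : Q₁ ≪ Q₀) (v u : V) (t : ℕ) (w : V) :
    vertexLaw G Q₀ Q₁ v t w ≪ vertexLaw G Q₀ Q₁ u t w := by
  unfold vertexLaw
  split_ifs
  exacts [Measure.AbsolutelyContinuous.rfl, h10, h01, Measure.AbsolutelyContinuous.rfl]

open Classical in
lemma vertexLaw_eq_of_notMem [G.LocallyFinite] (hc : G.Connected) {v u : V} {t : ℕ} {w : V}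
    (hw : w ∉ ballFinset G v t ∪ ballFinset G u t) :
    vertexLaw G Q₀ Q₁ v t w = vertexLaw G Q₀ Q₁ u t w := by
  rw [Finset.mem_union, mem_ballFinset hc, mem_ballFinset hc, not_or] at hw
  rw [vertexLaw, vertexLaw, if_neg hw.1, if_neg hw.2]

variable [IsProbabilityMeasure Q₀] [IsProbabilityMeasure Q₁]

lemma lintegral_enorm_llr_vertexLaw_le (v u : V) (t : ℕ) (w : V) :
    ∫⁻ x, ‖llr (vertexLaw G Q₀ Q₁ v t w) (vertexLaw G Q₀ Q₁ u t w) x‖ₑ ∂vertexLaw G Q₀ Q₁ v t w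
      ≤ ∫⁻ x, ‖llr Q₁ Q₀ x‖ₑ ∂Q₁ + ∫⁻ x, ‖llr Q₀ Q₁ x‖ₑ ∂Q₀ := by
  have hself : ∀ μ : Measure ℝ, IsProbabilityMeasure μ → ∫⁻ x, ‖llr μ μ x‖ₑ ∂μ = 0 := by
    intro μ _
    rw [lintegral_congr_ae (g := fun _ => 0), lintegral_zero]
    filter_upwards [llr_self μ] with x hx
    simp [hx]
  unfold vertexLaw
  split_ifs
  · simp [hself Q₁ inferInstance]
  · exact le_self_add
  · exact le_add_self
  · simp [hself Q₀ inferInstance]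

variable [G.LocallyFinite]

lemma stateLaw_absolutelyContinuous (hc : G.Connected) (h01 : Q₀ ≪ Q₁) (h10 : Q₁ ≪ Q₀)
    (v u : V) (t : ℕ) : stateLaw G Q₀ Q₁ v t ≪ stateLaw G Q₀ Q₁ u t := by
  classical
  exact infinitePi_absolutelyContinuous
    (fun w _ => vertexLaw_absolutelyContinuous h01 h10 v u t w)
    (fun w hw => vertexLaw_eq_of_notMem hc hw)

lemma affinity_stateLaw_le_one (hc : G.Connected) (h01 : Q₀ ≪ Q₁) (h10 : Q₁ ≪ Q₀)
    (v u : V) (t : ℕ) : affinity (stateLaw G Q₀ Q₁ v t) (stateLaw G Q₀ Q₁ u t) ≤ 1 :=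
  affinity_le_one (stateLaw_absolutelyContinuous hc h01 h10 v u t)

/-- Vertices at distance `t` from `v`, in branches away from `u`, are too far from `u` to be reached
by time `t`. Each contributes a factor `affinity Q₁ Q₀`; all other factors are at most one. -/
lemma affinity_stateLaw_le (hT : G.IsTree) (h01 : Q₀ ≪ Q₁) (h10 : Q₁ ≪ Q₀) {k : ℕ}
    (hReg : G.IsRegularOfDegree k) {v u : V} (hvu : v ≠ u) (t : ℕ) :
    affinity (stateLaw G Q₀ Q₁ v t) (stateLaw G Q₀ Q₁ u t)
      ≤ affinity Q₁ Q₀ ^ ((k - 1) ^ t) := by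
  classical
  have hc := hT.connected
  set A := (sphere G v t).filter fun w => G.dist u w = t + G.dist u v with hA
  have hd : 0 < G.dist u v := hc.pos_dist_of_ne hvu.symm
  have hmem : ∀ w ∈ A, G.dist v w ≤ t ∧ ¬ G.dist u w ≤ t := by
    intro w hw
    rw [hA, Finset.mem_filter, mem_sphere hc] at hw
    omega
  have hsub : A ⊆ ballFinset G v t ∪ ballFinset G u t := fun w hw =>
    Finset.mem_union_left _ ((mem_ballFinset hc).2 (hmem w hw).1)
  unfold stateLaw
  rw [affinity_infinitePi (S := ballFinset G v t ∪ ballFinset G u t)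
    (fun w _ => vertexLaw_absolutelyContinuous h01 h10 v u t w)
    (fun w hw => vertexLaw_eq_of_notMem hc hw), ← Finset.prod_sdiff hsub]
  have h1 : ∏ w ∈ (ballFinset G v t ∪ ballFinset G u t) \ A,
      affinity (vertexLaw G Q₀ Q₁ v t w) (vertexLaw G Q₀ Q₁ u t w) ≤ 1 :=
    Finset.prod_le_one' fun w _ =>
      affinity_le_one (vertexLaw_absolutelyContinuous h01 h10 v u t w)
  have h2 : ∏ w ∈ A, affinity (vertexLaw G Q₀ Q₁ v t w) (vertexLaw G Q₀ Q₁ u t w)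
      = affinity Q₁ Q₀ ^ A.card := by
    refine Finset.prod_eq_pow_card fun w hw => ?_
    rw [vertexLaw, vertexLaw, if_pos (hmem w hw).1, if_neg (hmem w hw).2]
  calc _ ≤ 1 * affinity Q₁ Q₀ ^ A.card := by rw [h2]; gcongr
    _ = affinity Q₁ Q₀ ^ A.card := one_mul _
    _ ≤ _ := pow_le_pow_right_of_le_one' (affinity_le_one h10) (pow_le_card_away hT hReg u v t)

/-- Only vertices in the two balls of radius `t` contribute. This is the ceiling on the growth of
information used for the lower bound on the runtime. -/
lemma lintegral_enorm_llr_stateLaw_le (hc : G.Connected) (h01 : Q₀ ≪ Q₁) (h10 : Q₁ ≪ Q₀) {k : ℕ}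
    (hk : 3 ≤ k) (hReg : G.IsRegularOfDegree k) (v u : V) (t : ℕ) :
    ∫⁻ x, ‖llr (stateLaw G Q₀ Q₁ v t) (stateLaw G Q₀ Q₁ u t) x‖ₑ ∂stateLaw G Q₀ Q₁ v t
      ≤ (2 * (k * (k - 1) ^ (t + 1)) : ℕ)
        * (∫⁻ x, ‖llr Q₁ Q₀ x‖ₑ ∂Q₁ + ∫⁻ x, ‖llr Q₀ Q₁ x‖ₑ ∂Q₀) := by
  classical
  refine (lintegral_enorm_llr_infinitePi_le (S := ballFinset G v t ∪ ballFinset G u t)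
    (fun w _ => vertexLaw_absolutelyContinuous h01 h10 v u t w)
    (fun w hw => vertexLaw_eq_of_notMem hc hw)).trans ?_
  refine (Finset.sum_le_sum fun w _ => lintegral_enorm_llr_vertexLaw_le v u t w).trans ?_
  rw [Finset.sum_const, nsmul_eq_mul]
  gcongr
  refine (Finset.card_union_le _ _).trans ?_
  have h1 := card_ballFinset_le hc hk hReg v t
  have h2 := card_ballFinset_le hc hk hReg u t
  omega

end States

/-! ### Change of measure and deviations of the cumulative likelihood ratio. -/

section SourceLaw

variable {V : Type*} {G : SimpleGraph V} {Q₀ Q₁ : Measure ℝ}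

lemma measurable_cumLLR (v u : V) (t : ℕ) : Measurable (cumLLR G Q₀ Q₁ v u t) :=
  Finset.measurable_sum _ fun s _ => (measurable_llr _ _).comp (measurable_pi_apply s)

lemma measurable_cumLLR_piLE (v u : V) {s t : ℕ} (hst : s ≤ t) :
    Measurable[Filtration.piLE (X := fun _ : ℕ => V → ℝ) t] (cumLLR G Q₀ Q₁ v u s) := by
  refine Finset.measurable_sum _ fun r hr => (measurable_llr _ _).comp ?_
  have hr' : r ≤ t := by rw [Finset.mem_range] at hr; omega
  have h1 : Measurable[Filtration.piLE (X := fun _ : ℕ => V → ℝ) t]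
      (Preorder.restrictLe (π := fun _ : ℕ => V → ℝ) t) := comap_measurable _
  exact (measurable_pi_apply (⟨r, hr'⟩ : Set.Iic t)).comp h1

/-- Product measures over time that agree up to time `t` agree on the events of the filtration
at time `t`. -/
lemma infinitePi_apply_eq_of_piLE {X : ℕ → Type*} [∀ i, MeasurableSpace (X i)]
    {μ ν : ∀ i, Measure (X i)} [∀ i, IsProbabilityMeasure (μ i)]
    [∀ i, IsProbabilityMeasure (ν i)] {t : ℕ} (h : ∀ s ≤ t, μ s = ν s) {A : Set (∀ i, X i)}
    (hA : MeasurableSet[Filtration.piLE (X := X) t] A) :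
    Measure.infinitePi μ A = Measure.infinitePi ν A := by
  rw [Filtration.piLE_eq_comap_frestrictLe] at hA
  obtain ⟨B, hB, rfl⟩ := hA
  have hm := Preorder.measurable_frestrictLe (X := X) t
  rw [← Measure.map_apply hm hB, ← Measure.map_apply hm hB]
  unfold Preorder.frestrictLe
  rw [Measure.infinitePi_map_restrict, Measure.infinitePi_map_restrict]
  congr 2
  funext i
  exact h i.1 (Finset.mem_Iic.1 i.2)

variable [IsProbabilityMeasure Q₀] [IsProbabilityMeasure Q₁]

lemma ae_sourceLaw_of_ae_stateLaw {v : V} (p : ℕ → (V → ℝ) → Prop)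
    (hp : ∀ s, ∀ᵐ y ∂stateLaw G Q₀ Q₁ v s, p s y) (t : ℕ) :
    ∀ᵐ ω ∂sourceLaw G Q₀ Q₁ v, ∀ s ∈ Finset.range t, p s (ω s) := by
  rw [Finset.eventually_all]
  intro s _
  exact (measurePreserving_eval_infinitePi (stateLaw G Q₀ Q₁ v) s).quasiMeasurePreserving.ae (hp s)

variable [G.LocallyFinite]

/-- Change of measure on the events observable up to time `t`. -/
lemma sourceLaw_apply_eq_lintegral (hc : G.Connected) (h01 : Q₀ ≪ Q₁) (h10 : Q₁ ≪ Q₀)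
    (u v : V) {t : ℕ} {A : Set (Obs V)}
    (hA : MeasurableSet[Filtration.piLE (X := fun _ : ℕ => V → ℝ) t] A) :
    sourceLaw G Q₀ Q₁ u A
      = ∫⁻ ω in A, ENNReal.ofReal (Real.exp (cumLLR G Q₀ Q₁ u v t ω)) ∂sourceLaw G Q₀ Q₁ v := by
  classical
  -- The density formula needs products that differ in finitely many factors. The hybrid `H` follows
  -- `u` up to time `t` and `v` afterwards, and agrees with the law of `u` on events observable by
  -- time `t`.
  let H : ℕ → Measure (V → ℝ) :=
    fun s => if s ≤ t then stateLaw G Q₀ Q₁ u s else stateLaw G Q₀ Q₁ v s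
  have hHle : ∀ s ≤ t, H s = stateLaw G Q₀ Q₁ u s := fun s hs => if_pos hs
  have : ∀ s, IsProbabilityMeasure (H s) := fun s => by
    simp only [H]; split_ifs <;> infer_instance
  have hden : Measure.infinitePi H = (sourceLaw G Q₀ Q₁ v).withDensity
      fun ω => ∏ s ∈ Finset.range (t + 1), (H s).rnDeriv (stateLaw G Q₀ Q₁ v s) (ω s) := by
    refine infinitePi_eq_withDensity_rnDeriv (P := H) (P' := stateLaw G Q₀ Q₁ v) ?_ ?_
    · intro s hs
      rw [hHle s (by rw [Finset.mem_range] at hs; omega)]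
      exact stateLaw_absolutelyContinuous hc h01 h10 u v s
    · intro s hs
      exact if_neg (by rw [Finset.mem_range] at hs; omega)
  have hA' : MeasurableSet A := (Filtration.piLE (X := fun _ : ℕ => V → ℝ)).le t A hA
  have h1 : sourceLaw G Q₀ Q₁ u A = Measure.infinitePi H A :=
    infinitePi_apply_eq_of_piLE (fun s hs => (hHle s hs).symm) hA
  rw [h1, hden, withDensity_apply _ hA']
  refine lintegral_congr_ae (ae_restrict_of_ae ?_)
  have h2 := ae_sourceLaw_of_ae_stateLaw (G := G) (Q₀ := Q₀) (Q₁ := Q₁) (v := v)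
    (fun s y => Real.exp (llr (stateLaw G Q₀ Q₁ u s) (stateLaw G Q₀ Q₁ v s) y)
      = ((stateLaw G Q₀ Q₁ u s).rnDeriv (stateLaw G Q₀ Q₁ v s) y).toReal
      ∧ (stateLaw G Q₀ Q₁ u s).rnDeriv (stateLaw G Q₀ Q₁ v s) y < ∞)
    (fun s => (exp_llr_of_ac' _ _ (stateLaw_absolutelyContinuous hc h01 h10 v u s)).and
      (Measure.rnDeriv_lt_top _ _)) (t + 1)
  filter_upwards [h2] with ω hω
  rw [cumLLR, Real.exp_sum, ENNReal.ofReal_prod_of_nonneg fun _ _ => (Real.exp_pos _).le]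
  refine Finset.prod_congr rfl fun s hs => ?_
  rw [hHle s (by rw [Finset.mem_range] at hs; omega), (hω s hs).1,
    ENNReal.ofReal_toReal (hω s hs).2.ne]

lemma sourceLaw_le_exp_mul (hc : G.Connected) (h01 : Q₀ ≪ Q₁) (h10 : Q₁ ≪ Q₀)
    (u v : V) {t : ℕ} {A : Set (Obs V)}
    (hA : MeasurableSet[Filtration.piLE (X := fun _ : ℕ => V → ℝ) t] A) {c : ℝ}
    (hle : ∀ ω ∈ A, cumLLR G Q₀ Q₁ u v t ω ≤ c) :
    sourceLaw G Q₀ Q₁ u A ≤ ENNReal.ofReal (Real.exp c) * sourceLaw G Q₀ Q₁ v A := by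
  have hA' : MeasurableSet A := (Filtration.piLE (X := fun _ : ℕ => V → ℝ)).le t A hA
  rw [sourceLaw_apply_eq_lintegral hc h01 h10 u v hA, ← setLIntegral_const]
  exact setLIntegral_mono' hA' fun ω hω =>
    ENNReal.ofReal_le_ofReal (Real.exp_le_exp.2 (hle ω hω))

lemma exp_mul_sourceLaw_le (hc : G.Connected) (h01 : Q₀ ≪ Q₁) (h10 : Q₁ ≪ Q₀)
    (u v : V) {t : ℕ} {A : Set (Obs V)}
    (hA : MeasurableSet[Filtration.piLE (X := fun _ : ℕ => V → ℝ) t] A) {c : ℝ}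
    (hle : ∀ ω ∈ A, c ≤ cumLLR G Q₀ Q₁ u v t ω) :
    ENNReal.ofReal (Real.exp c) * sourceLaw G Q₀ Q₁ v A ≤ sourceLaw G Q₀ Q₁ u A := by
  have hA' : MeasurableSet A := (Filtration.piLE (X := fun _ : ℕ => V → ℝ)).le t A hA
  rw [sourceLaw_apply_eq_lintegral hc h01 h10 u v hA, ← setLIntegral_const]
  exact setLIntegral_mono' hA' fun ω hω =>
    ENNReal.ofReal_le_ofReal (Real.exp_le_exp.2 (hle ω hω))

/-- A Chernoff bound at exponent `1/2`, where the exponential moment is a product of affinities over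
time. Keeping only the last factor loses nothing essential, as `(k - 1) ^ t` already has the order
of the whole sum. -/
lemma sourceLaw_cumLLR_lt_le (hT : G.IsTree) (h01 : Q₀ ≪ Q₁) (h10 : Q₁ ≪ Q₀) {k : ℕ}
    (hReg : G.IsRegularOfDegree k) {v u : V} (hvu : v ≠ u) (t : ℕ) (c : ℝ) :
    sourceLaw G Q₀ Q₁ v {ω | cumLLR G Q₀ Q₁ v u t ω < c}
      ≤ ENNReal.ofReal (Real.exp (c / 2)) * affinity Q₁ Q₀ ^ ((k - 1) ^ t) := by
  have hc := hT.connected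
  have hm := measurable_cumLLR (G := G) (Q₀ := Q₀) (Q₁ := Q₁) v u t
  have hint : ∫⁻ ω, ENNReal.ofReal (Real.exp (-(cumLLR G Q₀ Q₁ v u t ω) / 2))
      ∂sourceLaw G Q₀ Q₁ v ≤ affinity Q₁ Q₀ ^ ((k - 1) ^ t) := by
    have h1 : ∀ ω, ENNReal.ofReal (Real.exp (-(cumLLR G Q₀ Q₁ v u t ω) / 2))
        = ∏ s ∈ Finset.range (t + 1), ENNReal.ofReal (Real.exp
          (-(llr (stateLaw G Q₀ Q₁ v s) (stateLaw G Q₀ Q₁ u s) (ω s)) / 2)) := by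
      intro ω
      rw [← ENNReal.ofReal_prod_of_nonneg fun i _ => (Real.exp_pos _).le, ← Real.exp_sum,
        ← Finset.sum_div, Finset.sum_neg_distrib, cumLLR]
    simp_rw [h1]
    unfold sourceLaw
    rw [lintegral_prod_infinitePi (stateLaw G Q₀ Q₁ v) (Finset.range (t + 1))
      (fun s y => ENNReal.ofReal (Real.exp
          (-(llr (stateLaw G Q₀ Q₁ v s) (stateLaw G Q₀ Q₁ u s) y) / 2)))
      (fun s => by
        have := measurable_llr (stateLaw G Q₀ Q₁ v s) (stateLaw G Q₀ Q₁ u s); fun_prop),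
      Finset.prod_range_succ]
    calc _ ≤ 1 * affinity Q₁ Q₀ ^ ((k - 1) ^ t) :=
          mul_le_mul' (Finset.prod_le_one' fun s _ => affinity_stateLaw_le_one hc h01 h10 v u s)
            (affinity_stateLaw_le hT h01 h10 hReg hvu t)
      _ = _ := one_mul _
  calc sourceLaw G Q₀ Q₁ v {ω | cumLLR G Q₀ Q₁ v u t ω < c}
      ≤ ∫⁻ ω, ENNReal.ofReal (Real.exp (c / 2))
          * ENNReal.ofReal (Real.exp (-(cumLLR G Q₀ Q₁ v u t ω) / 2))
          ∂sourceLaw G Q₀ Q₁ v := by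
        rw [← lintegral_indicator_one (measurableSet_lt hm measurable_const)]
        refine lintegral_mono fun ω => Set.indicator_apply_le' (fun hω => ?_) (fun _ => zero_le)
        rw [← ENNReal.ofReal_mul (Real.exp_pos _).le, ← Real.exp_add, Pi.one_apply,
          ← ENNReal.ofReal_one]
        refine ENNReal.ofReal_le_ofReal (Real.one_le_exp ?_)
        have : cumLLR G Q₀ Q₁ v u t ω < c := hω
        linarith
    _ = ENNReal.ofReal (Real.exp (c / 2)) * ∫⁻ ω,
          ENNReal.ofReal (Real.exp (-(cumLLR G Q₀ Q₁ v u t ω) / 2)) ∂sourceLaw G Q₀ Q₁ v :=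
        lintegral_const_mul _ (by fun_prop)
    _ ≤ _ := by gcongr

lemma lintegral_enorm_cumLLR_le (hc : G.Connected) (h01 : Q₀ ≪ Q₁) (h10 : Q₁ ≪ Q₀) {k : ℕ}
    (hk : 3 ≤ k) (hReg : G.IsRegularOfDegree k) (v u : V) (t : ℕ) :
    ∫⁻ ω, ‖cumLLR G Q₀ Q₁ v u t ω‖ₑ ∂sourceLaw G Q₀ Q₁ v
      ≤ ((t + 1) * (2 * (k * (k - 1) ^ (t + 1))) : ℕ)
        * (∫⁻ x, ‖llr Q₁ Q₀ x‖ₑ ∂Q₁ + ∫⁻ x, ‖llr Q₀ Q₁ x‖ₑ ∂Q₀) := by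
  set K := ∫⁻ x, ‖llr Q₁ Q₀ x‖ₑ ∂Q₁ + ∫⁻ x, ‖llr Q₀ Q₁ x‖ₑ ∂Q₀ with hK
  have hm : ∀ s, Measurable fun y =>
      ‖llr (stateLaw G Q₀ Q₁ v s) (stateLaw G Q₀ Q₁ u s) y‖ₑ :=
    fun s => (measurable_llr _ _).enorm
  calc ∫⁻ ω, ‖cumLLR G Q₀ Q₁ v u t ω‖ₑ ∂sourceLaw G Q₀ Q₁ v
      ≤ ∫⁻ ω, ∑ s ∈ Finset.range (t + 1),
          ‖llr (stateLaw G Q₀ Q₁ v s) (stateLaw G Q₀ Q₁ u s) (ω s)‖ₑ ∂sourceLaw G Q₀ Q₁ v :=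
        lintegral_mono fun ω => enorm_sum_le _ _
    _ = ∑ s ∈ Finset.range (t + 1), ∫⁻ ω : Obs V,
          ‖llr (stateLaw G Q₀ Q₁ v s) (stateLaw G Q₀ Q₁ u s) (ω s)‖ₑ ∂sourceLaw G Q₀ Q₁ v :=
        lintegral_finsetSum _ fun s _ => (hm s).comp (measurable_pi_apply s)
    _ = ∑ s ∈ Finset.range (t + 1), ∫⁻ y,
          ‖llr (stateLaw G Q₀ Q₁ v s) (stateLaw G Q₀ Q₁ u s) y‖ₑ ∂stateLaw G Q₀ Q₁ v s :=
        Finset.sum_congr rfl fun s _ =>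
          (measurePreserving_eval_infinitePi (stateLaw G Q₀ Q₁ v) s).lintegral_comp (hm s)
    _ ≤ ∑ s ∈ Finset.range (t + 1), ((2 * (k * (k - 1) ^ (t + 1)) : ℕ) : ℝ≥0∞) * K := by
        refine Finset.sum_le_sum fun s hs => ?_
        refine (lintegral_enorm_llr_stateLaw_le hc h01 h10 hk hReg v u s).trans ?_
        have h1 : (k - 1) ^ (s + 1) ≤ (k - 1) ^ (t + 1) :=
          Nat.pow_le_pow_right (by omega) (by rw [Finset.mem_range] at hs; omega)
        gcongr
    _ = _ := by
        rw [Finset.sum_const, Finset.card_range, nsmul_eq_mul, ← mul_assoc, ← Nat.cast_mul]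

end SourceLaw

end Cascade

namespace Cascade

/-! ### Measurable maximisers and tail sums. -/

section Measurability

variable {Ω V : Type*} [MeasurableSpace Ω]

/-- A finite family of measurable functions has a measurable selection of a maximiser. -/
lemma exists_measurable_argmax {W : Finset V} (hW : W.Nonempty) (f : V → Ω → EReal)
    (hf : ∀ v, Measurable (f v)) :
    ∃ D : Ω → V, (∀ ω, D ω ∈ W) ∧ (∀ u, MeasurableSet {ω | D ω = u}) ∧
      ∀ ω, ∀ v ∈ W, f v ω ≤ f (D ω) ω := by
  classical
  induction hW using Finset.Nonempty.cons_induction with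
  | singleton a =>
    exact ⟨fun _ => a, fun _ => by simp, fun u => MeasurableSet.const _, fun ω v hv => by
      rw [Finset.mem_singleton.1 hv]⟩
  | cons a s ha hs ih =>
    obtain ⟨D, hD, hDm, hDmax⟩ := ih
    have hE : MeasurableSet {ω | f (D ω) ω ≤ f a ω} := by
      have : {ω | f (D ω) ω ≤ f a ω} = ⋃ v ∈ s, ({ω | D ω = v} ∩ {ω | f v ω ≤ f a ω}) := by
        ext ω
        simp only [Set.mem_ofPred_eq, Set.mem_iUnion, Set.mem_inter_iff, exists_prop]
        constructor
        · exact fun h => ⟨D ω, hD ω, rfl, h⟩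
        · rintro ⟨v, -, rfl, h⟩; exact h
      rw [this]
      exact Finset.measurableSet_biUnion _ fun v _ =>
        (hDm v).inter (measurableSet_le (hf v) (hf a))
    refine ⟨fun ω => if f (D ω) ω ≤ f a ω then a else D ω, fun ω => ?_, fun u => ?_,
      fun ω v hv => ?_⟩
    · dsimp only
      split_ifs
      · exact Finset.mem_cons_self a s
      · exact Finset.mem_cons_of_mem (hD ω)
    · have : {ω | (if f (D ω) ω ≤ f a ω then a else D ω) = u}
          = ({ω | f (D ω) ω ≤ f a ω} ∩ {_ω | a = u})
            ∪ ({ω | f (D ω) ω ≤ f a ω}ᶜ ∩ {ω | D ω = u}) := by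
        ext ω
        by_cases h : f (D ω) ω ≤ f a ω <;> simp [h]
      rw [this]
      exact (hE.inter (MeasurableSet.const _)).union (hE.compl.inter (hDm u))
    · dsimp only
      split_ifs with h
      · rcases Finset.mem_cons.1 hv with rfl | hv
        · exact le_rfl
        · exact (hDmax ω v hv).trans h
      · rcases Finset.mem_cons.1 hv with rfl | hv
        · exact (not_le.1 h).le
        · exact hDmax ω v hv

lemma enat_eq_tsum (T : ℕ∞) : (T : ℝ≥0∞) = ∑' t : ℕ, if (t : ℕ∞) < T then 1 else 0 := by
  induction T using ENat.recTopCoe with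
  | top => simp
  | coe n =>
    rw [tsum_eq_sum (s := Finset.range n)]
    · rw [Finset.sum_congr rfl (g := fun _ => 1)]
      · simp
      · intro t ht; rw [if_pos (by simpa using ht)]
    · intro t ht; rw [if_neg (by simpa using ht)]

lemma lintegral_enat_le (μ : Measure Ω) [IsProbabilityMeasure μ] (T : Ω → ℕ∞)
    (hT : ∀ t : ℕ, MeasurableSet {ω | (t : ℕ∞) < T ω}) (N : ℕ) :
    ∫⁻ ω, (T ω : ℝ≥0∞) ∂μ ≤ N + ∑' j : ℕ, μ {ω | ((j + N : ℕ) : ℕ∞) < T ω} := by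
  classical
  have h1 : ∀ ω, (T ω : ℝ≥0∞)
      = ∑' t : ℕ, ({ω | (t : ℕ∞) < T ω} : Set Ω).indicator (fun _ => 1) ω := by
    intro ω
    rw [enat_eq_tsum (T ω)]
    exact tsum_congr fun t => by simp [Set.indicator_apply]
  simp_rw [h1]
  rw [lintegral_tsum fun t => (measurable_const.indicator (hT t)).aemeasurable]
  have h2 : ∀ t : ℕ, ∫⁻ ω, ({ω | (t : ℕ∞) < T ω} : Set Ω).indicator (fun _ => 1) ω ∂μ
      = μ {ω | (t : ℕ∞) < T ω} := fun t => lintegral_indicator_one (hT t)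
  simp_rw [h2]
  rw [← ENNReal.summable.sum_add_tsum_nat_add' (k := N)]
  gcongr
  calc ∑ t ∈ Finset.range N, μ {ω | (t : ℕ∞) < T ω} ≤ ∑ t ∈ Finset.range N, 1 :=
        Finset.sum_le_sum fun t _ => prob_le_one
    _ = N := by simp

end Measurability

/-! ### Admissibility, and bounds on stopping times at fixed `n`. -/

section Estimators

variable {V : Type*} {G : SimpleGraph V} {Q₀ Q₁ : Measure ℝ} {W : Finset V} {R : ℕ} {α : ℝ}

lemma measurable_minLLR_piLE (v : V) {s t : ℕ} (hst : s ≤ t) :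
    Measurable[Filtration.piLE (X := fun _ : ℕ => V → ℝ) t] (minLLR G Q₀ Q₁ W R v s) := by
  refine Measurable.biInf _ W.countable_toSet fun u _ => Measurable.iInf fun _ => ?_
  exact measurable_coe_real_ereal.comp (measurable_cumLLR_piLE v u hst)

lemma msprtTime_le_iff {ω : Obs V} {t : ℕ} : msprtTime G Q₀ Q₁ W R α ω ≤ t ↔
    ∃ v ∈ W, ∃ s ≤ t, ((Real.log ((W.card : ℝ) / α) : ℝ) : EReal) ≤ minLLR G Q₀ Q₁ W R v s ω := by
  -- The strict form lets `iInf_lt_iff` extract witnesses from the nested infima.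
  have hlt : ∀ x : ℕ∞, x ≤ t ↔ x < (t : ℕ∞) + 1 := fun x =>
    (ENat.lt_add_one_iff (ENat.natCast_ne_top t)).symm
  rw [hlt, msprtTime]
  simp only [msprtTimeAt, iInf_lt_iff]
  simp only [← hlt, Nat.cast_le, exists_prop]
  refine exists_congr fun v => and_congr_right fun _ => exists_congr fun s => and_comm

lemma measurableSet_msprtTime_le (t : ℕ) :
    MeasurableSet[Filtration.piLE (X := fun _ : ℕ => V → ℝ) t]
      {ω | msprtTime G Q₀ Q₁ W R α ω ≤ (t : ℕ∞)} := by
  have : {ω | msprtTime G Q₀ Q₁ W R α ω ≤ (t : ℕ∞)} = ⋃ v ∈ W, ⋃ s ∈ Finset.range (t + 1),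
      {ω | ((Real.log ((W.card : ℝ) / α) : ℝ) : EReal) ≤ minLLR G Q₀ Q₁ W R v s ω} := by
    ext ω
    simp [msprtTime_le_iff]
  rw [this]
  refine Finset.measurableSet_biUnion _ fun v _ => Finset.measurableSet_biUnion _ fun s hs => ?_
  exact (measurable_minLLR_piLE v (by rw [Finset.mem_range] at hs; omega)) measurableSet_Ici

lemma exists_isMSPRT (hW : W.Nonempty) :
    ∃ E : SequentialEstimator W, IsMSPRT G Q₀ Q₁ W R α E := by
  have h : ∀ t : ℕ, ∃ D : Obs V → V, (∀ ω, D ω ∈ W) ∧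
      (∀ u, MeasurableSet[Filtration.piLE (X := fun _ : ℕ => V → ℝ) t] {ω | D ω = u}) ∧
      ∀ ω, ∀ v ∈ W, minLLR G Q₀ Q₁ W R v t ω ≤ minLLR G Q₀ Q₁ W R (D ω) t ω := fun t =>
    @exists_measurable_argmax _ _ (Filtration.piLE (X := fun _ : ℕ => V → ℝ) t) W hW
      (fun v => minLLR G Q₀ Q₁ W R v t) fun v => measurable_minLLR_piLE v le_rfl
  choose D hD hDm hDmax using h
  exact ⟨⟨D, msprtTime G Q₀ Q₁ W R α, hD, hDm, measurableSet_msprtTime_le⟩,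
    ⟨fun _ => rfl, hDmax⟩⟩

/-- The event that the estimator stops at time `t` with output `u`. -/
def SequentialEstimator.stopsWith (E : SequentialEstimator W) (t : ℕ) (u : V) : Set (Obs V) :=
  {ω | E.T ω = (t : ℕ∞) ∧ E.D t ω = u}

lemma SequentialEstimator.measurableSet_stopsWith (E : SequentialEstimator W) (t : ℕ) (u : V) :
    MeasurableSet[Filtration.piLE (X := fun _ : ℕ => V → ℝ) t] (E.stopsWith t u) := by
  have : E.stopsWith t u = ({ω | E.T ω ≤ (t : ℕ∞)} \ ⋃ s ∈ Finset.range t,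
      {ω | E.T ω ≤ (s : ℕ∞)}) ∩ {ω | E.D t ω = u} := by
    ext ω
    simp only [stopsWith, Set.mem_ofPred_eq, Set.mem_inter_iff, Set.mem_sdiff, Set.mem_iUnion,
      Finset.mem_range, exists_prop, not_exists, not_and, not_le]
    refine and_congr_left fun _ => ⟨fun h => ?_, fun h => ?_⟩
    · rw [h]; exact ⟨le_rfl, fun s hs => by exact_mod_cast hs⟩
    · obtain ⟨m, hm⟩ := ENat.ne_top_iff_exists.1 (ne_top_of_le_ne_top (ENat.natCast_ne_top t) h.1)
      rw [← hm] at h ⊢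
      have h1 : m ≤ t := by exact_mod_cast h.1
      rcases h1.lt_or_eq with h2 | h2
      · exact absurd (h.2 m h2) (lt_irrefl _)
      · rw [h2]
  rw [this]
  refine ((E.T_stopping t).diff (Finset.measurableSet_biUnion _ fun s hs => ?_)).inter
    (E.D_adapted t u)
  exact (Filtration.piLE (X := fun _ : ℕ => V → ℝ)).mono (Finset.mem_range.1 hs).le _
    (E.T_stopping s)

lemma SequentialEstimator.outputs_eq_iUnion (E : SequentialEstimator W) (u : V) :
    E.outputs u = ⋃ t, E.stopsWith t u := by
  ext ω
  simp [outputs, stopsWith]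

/-- When the test stops, some row minimum clears the threshold; the estimate maximises the row
minima at that same time, so its own row clears it too. -/
lemma IsMSPRT.le_cumLLR {E : SequentialEstimator W} (hE : IsMSPRT G Q₀ Q₁ W R α E) {t : ℕ}
    {u v : V} (hv : v ∈ W) (huv : R < G.dist u v) {ω : Obs V} (hω : ω ∈ E.stopsWith t u) :
    Real.log ((W.card : ℝ) / α) ≤ cumLLR G Q₀ Q₁ u v t ω := by
  obtain ⟨hT, hD⟩ := hω
  have hT' := hE.time_eq ω ▸ hT
  obtain ⟨w, hw, s, hs, hle⟩ := msprtTime_le_iff.1 hT'.le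
  have hst : s = t := by
    refine le_antisymm hs ?_
    have := hT' ▸ msprtTime_le_iff.2 ⟨w, hw, s, le_rfl, hle⟩
    exact_mod_cast this
  subst hst
  have h1 := hle.trans (hE.isMax s ω w hw)
  rw [hD, minLLR] at h1
  simp only [le_iInf_iff] at h1
  exact_mod_cast h1 v hv huv

variable [IsProbabilityMeasure Q₀] [IsProbabilityMeasure Q₁] [G.LocallyFinite]

/-- On each event of stopping at `t` with output `u`, the density of the law of `u` against that of
`v` is at least `|W| / α`. These events are disjoint, so summing their probabilities under `u` gives
at most one. -/
lemma IsMSPRT.mem_admissible (hc : G.Connected) (h01 : Q₀ ≪ Q₁) (h10 : Q₁ ≪ Q₀) (hα : 0 < α)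
    {E : SequentialEstimator W} (hE : IsMSPRT G Q₀ Q₁ W R α E) :
    E ∈ admissible G Q₀ Q₁ W R α := by
  intro u hu v hv huv
  have hW : 0 < (W.card : ℝ) := by exact_mod_cast Finset.card_pos.2 ⟨u, hu⟩
  have hpos : 0 < (W.card : ℝ) / α := by positivity
  have hdisj : Pairwise (Function.onFun Disjoint fun t => E.stopsWith t u) := by
    intro s t hst
    refine Set.disjoint_left.2 fun ω hs ht => hst ?_
    have := hs.1.symm.trans ht.1
    exact_mod_cast this
  have hmeas : ∀ t, MeasurableSet (E.stopsWith t u) := fun t =>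
    (Filtration.piLE (X := fun _ : ℕ => V → ℝ)).le t _ (E.measurableSet_stopsWith t u)
  have hmul : ENNReal.ofReal ((W.card : ℝ) / α) * sourceLaw G Q₀ Q₁ v (E.outputs u) ≤ 1 := by
    calc ENNReal.ofReal ((W.card : ℝ) / α) * sourceLaw G Q₀ Q₁ v (E.outputs u)
        = ∑' t, ENNReal.ofReal ((W.card : ℝ) / α) * sourceLaw G Q₀ Q₁ v (E.stopsWith t u) := by
          rw [E.outputs_eq_iUnion, measure_iUnion hdisj hmeas, ENNReal.tsum_mul_left]
      _ ≤ ∑' t, sourceLaw G Q₀ Q₁ u (E.stopsWith t u) := by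
          refine ENNReal.tsum_le_tsum fun t => ?_
          have := exp_mul_sourceLaw_le hc h01 h10 u v (E.measurableSet_stopsWith t u)
            fun ω hω => hE.le_cumLLR hv huv hω
          rwa [Real.exp_log hpos] at this
      _ = sourceLaw G Q₀ Q₁ u (⋃ t, E.stopsWith t u) := (measure_iUnion hdisj hmeas).symm
      _ ≤ 1 := prob_le_one
  rw [← inv_div, ENNReal.ofReal_inv_of_pos hpos]
  rwa [ENNReal.le_inv_iff_mul_le, mul_comm]

lemma optRuntime_le_worstRuntime_msprtTime (hc : G.Connected) (h01 : Q₀ ≪ Q₁) (h10 : Q₁ ≪ Q₀)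
    (hα : 0 < α) (hW : W.Nonempty) :
    optRuntime G Q₀ Q₁ W R α ≤ worstRuntime G Q₀ Q₁ W (msprtTime G Q₀ Q₁ W R α) := by
  obtain ⟨E, hE⟩ := exists_isMSPRT (G := G) (Q₀ := Q₀) (Q₁ := Q₁) (R := R) (α := α) hW
  refine (iInf₂_le E (hE.mem_admissible hc h01 h10 hα)).trans_eq ?_
  rw [show E.T = msprtTime G Q₀ Q₁ W R α from funext hE.time_eq]

/-- If the test is still running after `t`, the row of the true source `v` has an entry below the
threshold at time `t`; a union bound over that row finishes. -/
lemma sourceLaw_lt_msprtTime_le (hT : G.IsTree) (h01 : Q₀ ≪ Q₁) (h10 : Q₁ ≪ Q₀) {k : ℕ}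
    (hReg : G.IsRegularOfDegree k) {v : V} (hv : v ∈ W) (t : ℕ) :
    sourceLaw G Q₀ Q₁ v {ω | (t : ℕ∞) < msprtTime G Q₀ Q₁ W R α ω}
      ≤ W.card * (ENNReal.ofReal (Real.exp (Real.log ((W.card : ℝ) / α) / 2))
        * affinity Q₁ Q₀ ^ ((k - 1) ^ t)) := by
  classical
  set c := Real.log ((W.card : ℝ) / α) with hc
  have hsub : {ω | (t : ℕ∞) < msprtTime G Q₀ Q₁ W R α ω}
      ⊆ ⋃ u ∈ W.erase v, {ω | cumLLR G Q₀ Q₁ v u t ω < c} := by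
    intro ω hω
    have h1 : ¬ ((c : ℝ) : EReal) ≤ minLLR G Q₀ Q₁ W R v t ω := fun h =>
      (not_le.2 hω) (msprtTime_le_iff.2 ⟨v, hv, t, le_rfl, h⟩)
    rw [minLLR] at h1
    simp only [le_iInf_iff, not_forall, EReal.coe_le_coe_iff, not_le] at h1
    obtain ⟨u, hu, hd, hlt⟩ := h1
    refine Set.mem_biUnion (x := u) ?_ hlt
    refine Finset.mem_coe.2 (Finset.mem_erase.2 ⟨?_, hu⟩)
    rintro rfl
    simp at hd
  refine (measure_mono hsub).trans ((measure_biUnion_finset_le _ _).trans ?_)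
  calc _ ≤ ∑ u ∈ W.erase v, (ENNReal.ofReal (Real.exp (c / 2))
        * affinity Q₁ Q₀ ^ ((k - 1) ^ t)) := Finset.sum_le_sum fun u hu =>
          sourceLaw_cumLLR_lt_le hT h01 h10 hReg (Finset.ne_of_mem_erase hu).symm t c
    _ ≤ _ := by
        rw [Finset.sum_const, nsmul_eq_mul]
        gcongr
        exact Finset.erase_subset _ _

lemma worstRuntime_msprtTime_le (hT : G.IsTree) (h01 : Q₀ ≪ Q₁) (h10 : Q₁ ≪ Q₀) {k : ℕ}
    (hReg : G.IsRegularOfDegree k) (N : ℕ) :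
    worstRuntime G Q₀ Q₁ W (msprtTime G Q₀ Q₁ W R α) ≤ N + ∑' j : ℕ,
      W.card * (ENNReal.ofReal (Real.exp (Real.log ((W.card : ℝ) / α) / 2))
        * affinity Q₁ Q₀ ^ ((k - 1) ^ (j + N))) := by
  refine iSup₂_le fun v hv => ?_
  refine (lintegral_enat_le _ _ (fun t => ?_) N).trans ?_
  · have h1 := (Filtration.piLE (X := fun _ : ℕ => V → ℝ)).le t _
      (measurableSet_msprtTime_le (G := G) (Q₀ := Q₀) (Q₁ := Q₁) (W := W) (R := R) (α := α) t)
    simpa [Set.compl_ofPred] using h1.compl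
  · gcongr with j
    exact sourceLaw_lt_msprtTime_le hT h01 h10 hReg hv _

/-- Bound on the probability that an admissible estimator stops early under the source `v`, by
comparison with another source `u` that is far away. -/
lemma sourceLaw_le_time_le (hc : G.Connected) (h01 : Q₀ ≪ Q₁) (h10 : Q₁ ≪ Q₀)
    {E : SequentialEstimator W} (hE : E ∈ admissible G Q₀ Q₁ W R α)
    {v u : V} (hv : v ∈ W) (hu : u ∈ W) (hd : 2 * R < G.dist v u) (t : ℕ) (c : ℝ) :
    sourceLaw G Q₀ Q₁ v {ω | E.T ω ≤ (t : ℕ∞)}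
      ≤ W.card * ENNReal.ofReal (α / W.card)
        + sourceLaw G Q₀ Q₁ v {ω | c < cumLLR G Q₀ Q₁ v u t ω}
        + ENNReal.ofReal (Real.exp c)
          * ((ballFinset G v R).card * ENNReal.ofReal (α / W.card)) := by
  classical
  set near := W.filter fun w => G.dist v w ≤ R with hnear
  set far := W.filter fun w => ¬ G.dist v w ≤ R with hfar
  set A : Set (Obs V) := ⋃ s ∈ Finset.range (t + 1), ⋃ w ∈ near, E.stopsWith s w with hA
  set B : Set (Obs V) := {ω | cumLLR G Q₀ Q₁ v u t ω ≤ c} with hB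
  have hAm : MeasurableSet[Filtration.piLE (X := fun _ : ℕ => V → ℝ) t] A := by
    refine Finset.measurableSet_biUnion _ fun s hs => Finset.measurableSet_biUnion _ fun w _ => ?_
    exact (Filtration.piLE (X := fun _ : ℕ => V → ℝ)).mono
      (by rw [Finset.mem_range] at hs; omega) _ (E.measurableSet_stopsWith s w)
  have hBm : MeasurableSet[Filtration.piLE (X := fun _ : ℕ => V → ℝ) t] B :=
    (measurable_cumLLR_piLE v u le_rfl) measurableSet_Iic
  -- An early stop has an output far from `v`, or meets atypically large evidence against `u`, or
  -- has a near output with controlled likelihood ratio. Only the last event needs a change of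
  -- measure.
  have hsub : {ω | E.T ω ≤ (t : ℕ∞)} ⊆ (⋃ w ∈ far, E.outputs w) ∪ Bᶜ ∪ (A ∩ B) := by
    intro ω hω
    obtain ⟨m, hm⟩ := ENat.ne_top_iff_exists.1 (ne_top_of_le_ne_top (ENat.natCast_ne_top t) hω)
    have hmt : m ≤ t := by
      have : E.T ω ≤ (t : ℕ∞) := hω
      rw [← hm] at this; exact_mod_cast this
    by_cases hn : G.dist v (E.D m ω) ≤ R
    · by_cases hω' : ω ∈ B
      · refine Or.inr ⟨?_, hω'⟩
        refine Set.mem_biUnion (x := m) (by simpa [Nat.lt_succ_iff] using hmt) ?_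
        exact Set.mem_biUnion (x := E.D m ω)
          (Finset.mem_coe.2 (Finset.mem_filter.2 ⟨E.D_mem m ω, hn⟩)) ⟨hm.symm, rfl⟩
      · exact Or.inl (Or.inr hω')
    · refine Or.inl (Or.inl ?_)
      exact Set.mem_biUnion (x := E.D m ω)
        (Finset.mem_coe.2 (Finset.mem_filter.2 ⟨E.D_mem m ω, hn⟩)) ⟨m, hm.symm, rfl⟩
  have hBc : Bᶜ = {ω | c < cumLLR G Q₀ Q₁ v u t ω} := by ext ω; simp [hB]
  have h1 : sourceLaw G Q₀ Q₁ v (⋃ w ∈ far, E.outputs w)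
      ≤ W.card * ENNReal.ofReal (α / W.card) := by
    refine (measure_biUnion_finset_le _ _).trans ?_
    calc _ ≤ ∑ w ∈ far, ENNReal.ofReal (α / W.card) := Finset.sum_le_sum fun w hw => by
          obtain ⟨hwW, hwd⟩ := Finset.mem_filter.1 hw
          exact hE w hwW v hv (by rw [SimpleGraph.dist_comm]; exact not_le.1 hwd)
      _ ≤ _ := by
          rw [Finset.sum_const, nsmul_eq_mul]
          gcongr
          exact Finset.filter_subset _ _
  -- Since `dist v u > 2R`, any output within `R` of `v` is farther than `R` from `u`, hence a
  -- penalised error under `u`.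
  have h2 : sourceLaw G Q₀ Q₁ u A
      ≤ (ballFinset G v R).card * ENNReal.ofReal (α / W.card) := by
    have hAsub : A ⊆ ⋃ w ∈ near, E.outputs w := by
      intro ω hω
      simp only [hA, Set.mem_iUnion] at hω
      obtain ⟨s, -, w, hw, hs⟩ := hω
      exact Set.mem_biUnion (x := w) hw ⟨s, hs⟩
    refine (measure_mono hAsub).trans ((measure_biUnion_finset_le _ _).trans ?_)
    calc _ ≤ ∑ w ∈ near, ENNReal.ofReal (α / W.card) := Finset.sum_le_sum fun w hw => by
          obtain ⟨hwW, hwd⟩ := Finset.mem_filter.1 hw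
          have : G.dist v u ≤ G.dist v w + G.dist w u := hc.dist_triangle
          exact hE w hwW u hu (by omega)
      _ ≤ _ := by
          rw [Finset.sum_const, nsmul_eq_mul]
          gcongr
          intro w hw
          exact (mem_ballFinset hc).2 (Finset.mem_filter.1 hw).2
  have h3 : sourceLaw G Q₀ Q₁ v (A ∩ B) ≤ ENNReal.ofReal (Real.exp c)
      * ((ballFinset G v R).card * ENNReal.ofReal (α / W.card)) := by
    refine (sourceLaw_le_exp_mul hc h01 h10 v u (hAm.inter hBm) fun ω hω => hω.2).trans ?_
    gcongr
    exact (measure_mono Set.inter_subset_left).trans h2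
  rw [← hBc]
  refine (measure_mono hsub).trans ((measure_union_le _ _).trans ?_)
  exact add_le_add ((measure_union_le _ _).trans (add_le_add_left h1 _)) h3

lemma sourceLaw_lt_cumLLR_le (hc : G.Connected) (h01 : Q₀ ≪ Q₁) (h10 : Q₁ ≪ Q₀) {k : ℕ}
    (hk : 3 ≤ k) (hReg : G.IsRegularOfDegree k) (v u : V) (t : ℕ) {c : ℝ} (hc0 : 0 < c) :
    sourceLaw G Q₀ Q₁ v {ω | c < cumLLR G Q₀ Q₁ v u t ω}
      ≤ ((t + 1) * (2 * (k * (k - 1) ^ (t + 1))) : ℕ)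
        * (∫⁻ x, ‖llr Q₁ Q₀ x‖ₑ ∂Q₁ + ∫⁻ x, ‖llr Q₀ Q₁ x‖ₑ ∂Q₀) / ENNReal.ofReal c := by
  have hm := measurable_cumLLR (G := G) (Q₀ := Q₀) (Q₁ := Q₁) v u t
  rw [ENNReal.le_div_iff_mul_le (Or.inl (by simpa using hc0)) (Or.inl ENNReal.ofReal_ne_top),
    mul_comm]
  refine le_trans ?_ (lintegral_enorm_cumLLR_le hc h01 h10 hk hReg v u t)
  refine le_trans ?_ (mul_meas_ge_le_lintegral hm.enorm (ENNReal.ofReal c))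
  gcongr
  intro hlt
  rw [Real.enorm_eq_ofReal_abs]
  exact ENNReal.ofReal_le_ofReal (hlt.le.trans (le_abs_self _))

lemma exists_far (hc : G.Connected) {k : ℕ} (hk : 3 ≤ k) (hReg : G.IsRegularOfDegree k) (v : V)
    (r : ℕ) (hW : k * (k - 1) ^ (r + 1) < W.card) : ∃ u ∈ W, r < G.dist v u := by
  by_contra! h
  have hsub : W ⊆ ballFinset G v r := fun u hu => (mem_ballFinset hc).2 (h u hu)
  exact absurd ((Finset.card_le_card hsub).trans (card_ballFinset_le hc hk hReg v r))
    (not_le.2 hW)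

end Estimators

end Cascade

namespace Cascade

/-! ### The iterated limit and elementary growth estimates. -/

section Asymptotics

/-- The tolerance is taken equal to `α` itself: after `n → ∞` at fixed `α`, the ratios lie between
constants depending on `α` that tend to one. The range `α < 1 / 4` keeps the lower constant
positive. -/
lemma asympEq_of_bounds {g o : ℕ → ℝ → ℝ≥0∞} {L : ℕ → ℝ} (hL : ∀ᶠ n in atTop, 0 < L n)
    (hog : ∀ α : ℝ, 0 < α → ∀ᶠ n in atTop, o n α ≤ g n α)
    (hg : ∀ α : ℝ, 0 < α → α < 1 / 4 →
      ∀ᶠ n in atTop, g n α ≤ ENNReal.ofReal ((1 + α) * L n))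
    (ho : ∀ α : ℝ, 0 < α → α < 1 / 4 →
      ∀ᶠ n in atTop, ENNReal.ofReal ((1 - α) * (1 - 2 * α) * L n) ≤ o n α) :
    AsympEq g o ∧ AsympEq o (fun n _ => ENNReal.ofReal (L n)) := by
  have hα : ∀ᶠ α : ℝ in 𝓝[>] 0, 0 < α ∧ α < 1 / 4 :=
    Ioo_mem_nhdsGT (by norm_num)
  have htend : ∀ f : ℝ → ℝ, ContinuousAt f 0 → f 0 = 1 →
      Tendsto (fun α => ENNReal.ofReal (f α)) (𝓝[>] 0) (𝓝 1) := by
    intro f hf hf0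
    have h1 : Tendsto f (𝓝[>] 0) (𝓝 1) := by
      rw [← hf0]; exact hf.tendsto.mono_left nhdsWithin_le_nhds
    simpa using ENNReal.tendsto_ofReal h1
  have hpos : ∀ α : ℝ, 0 < α → α < 1 / 4 → 0 < (1 - α) * (1 - 2 * α) := fun α h0 h1 =>
    mul_pos (by linarith) (by linarith)
  refine ⟨⟨?_, ?_⟩, ⟨?_, ?_⟩⟩
  · refine le_liminf_of_le (by isBoundedDefault) ?_
    filter_upwards [hα] with α ⟨h0, h1⟩
    refine le_liminf_of_le (by isBoundedDefault) ?_
    filter_upwards [hL, hog α h0, hg α h0 h1, ho α h0 h1] with n hn h2 h3 h4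
    have hne : o n α ≠ 0 :=
      ((ENNReal.ofReal_pos.2 (mul_pos (hpos α h0 h1) hn)).trans_le h4).ne'
    have hnt : o n α ≠ ∞ := ne_top_of_le_ne_top ENNReal.ofReal_ne_top (h2.trans h3)
    rw [ENNReal.le_div_iff_mul_le (Or.inl hne) (Or.inl hnt), one_mul]
    exact h2
  · have h1 := htend (fun α => (1 + α) / ((1 - α) * (1 - 2 * α)))
      (ContinuousAt.div (by fun_prop) (by fun_prop) (by norm_num)) (by norm_num)
    unfold AsympLE
    rw [← h1.limsup_eq]
    refine limsup_le_limsup ?_ (by isBoundedDefault) (by isBoundedDefault)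
    filter_upwards [hα] with α ⟨h0, h1⟩
    refine limsup_le_of_le (by isBoundedDefault) ?_
    filter_upwards [hL, hg α h0 h1, ho α h0 h1] with n hn h3 h4
    have hp := hpos α h0 h1
    have hp' : 0 < (1 - α) * (1 - 2 * α) * L n := mul_pos hp hn
    refine (ENNReal.div_le_div h3 h4).trans_eq ?_
    rw [← ENNReal.ofReal_div_of_pos hp', mul_div_mul_right _ _ hn.ne']
  · have h1 := htend (fun α => (1 - α) * (1 - 2 * α)) (by fun_prop) (by norm_num)
    unfold AsympGE
    rw [← h1.liminf_eq]
    refine liminf_le_liminf ?_ (by isBoundedDefault) (by isBoundedDefault)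
    filter_upwards [hα] with α ⟨h0, h1⟩
    refine le_liminf_of_le (by isBoundedDefault) ?_
    filter_upwards [hL, ho α h0 h1] with n hn h4
    refine le_trans (le_of_eq ?_) (ENNReal.div_le_div_right h4 _)
    rw [← ENNReal.ofReal_div_of_pos hn, mul_div_cancel_right₀ _ hn.ne']
  · have h1 := htend (fun α => 1 + α) (by fun_prop) (by norm_num)
    unfold AsympLE
    rw [← h1.limsup_eq]
    refine limsup_le_limsup ?_ (by isBoundedDefault) (by isBoundedDefault)
    filter_upwards [hα] with α ⟨h0, h1⟩
    refine limsup_le_of_le (by isBoundedDefault) ?_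
    filter_upwards [hL, hog α h0, hg α h0 h1] with n hn h2 h3
    refine (ENNReal.div_le_div_right (h2.trans h3) _).trans_eq ?_
    rw [← ENNReal.ofReal_div_of_pos hn, mul_div_cancel_right₀ _ hn.ne']

lemma tendsto_log_natCast : Tendsto (fun n : ℕ => Real.log n) atTop atTop :=
  Real.tendsto_log_atTop.comp tendsto_natCast_atTop_atTop

/-- With `x = log n` and `a = log α`, the left side bounds the logarithm of the union bound `n * √(n
/ α) * ρ ^ ((k - 1) ^ N)`, where `c = -log ρ`. -/
lemma eventually_sub_rpow_le {c ε : ℝ} (hc : 0 < c) (hε : 0 < ε) (a : ℝ) :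
    ∀ᶠ x : ℝ in atTop, x + (x - a) / 2 - c * x ^ (1 + ε) ≤ - Real.log 2 := by
  have h1 : ∀ᶠ x : ℝ in atTop, 2 / c ≤ x ^ ε := (tendsto_rpow_atTop hε).eventually_ge_atTop _
  filter_upwards [h1, eventually_gt_atTop 0, eventually_ge_atTop (2 * Real.log 2 - a)]
    with x hx hx0 hx1
  rw [Real.rpow_add hx0, Real.rpow_one]
  have h2 : 2 ≤ c * x ^ ε := by rwa [div_le_iff₀' hc] at hx
  nlinarith

lemma eventually_log_mul_rpow_le {ε : ℝ} (hε : 0 < ε) (b M : ℝ) {δ : ℝ} (hδ : 0 < δ) :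
    ∀ᶠ x : ℝ in atTop, (Real.log x / b + 1) * M * x ^ (-ε) ≤ δ := by
  have h1 : Tendsto (fun x : ℝ => Real.log x / x ^ ε) atTop (𝓝 0) :=
    (isLittleO_log_rpow_atTop hε).tendsto_div_nhds_zero
  have h2 : Tendsto (fun x : ℝ => x ^ (-ε)) atTop (𝓝 0) := tendsto_rpow_neg_atTop hε
  have h3 : Tendsto (fun x : ℝ => (M / b) * (Real.log x / x ^ ε) + M * x ^ (-ε)) atTop (𝓝 0) := by
    simpa using (h1.const_mul (M / b)).add (h2.const_mul M)
  filter_upwards [h3.eventually (eventually_le_nhds hδ), eventually_gt_atTop 0] with x hx hx0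
  refine le_trans (le_of_eq ?_) hx
  rw [Real.rpow_neg hx0.le]
  ring

lemma eventually_mul_exp_neg_le (M : ℝ) {a δ : ℝ} (ha : 0 < a) (hδ : 0 < δ) :
    ∀ᶠ x : ℝ in atTop, M * Real.exp (-(a * x)) ≤ δ := by
  have h1 : Tendsto (fun x : ℝ => M * Real.exp (-(a * x))) atTop (𝓝 (M * 0)) :=
    (Real.tendsto_exp_neg_atTop_nhds_zero.comp (tendsto_id.const_mul_atTop ha)).const_mul M
  rw [mul_zero] at h1
  exact h1.eventually (eventually_le_nhds hδ)

lemma rpow_mul_log_div_log {b x : ℝ} (hb : 1 < b) (hx : 0 < x) (a : ℝ) :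
    b ^ (a * (Real.log x / Real.log b)) = x ^ a := by
  have hlb : Real.log b ≠ 0 := (Real.log_pos hb).ne'
  rw [Real.rpow_def_of_pos (by linarith), Real.rpow_def_of_pos hx]
  congr 1
  field_simp

end Asymptotics

/-! ### The matching runtime bounds. -/

section Runtime

variable {V : Type*} {G : SimpleGraph V} [G.LocallyFinite] {Q₀ Q₁ : Measure ℝ}
  [IsProbabilityMeasure Q₀] [IsProbabilityMeasure Q₁] {k : ℕ}

/-- Because `b ^ (j + N) ≥ b ^ N * (j + 1)`, the doubly exponential tail is dominated by a geometric
series of ratio `1/2`. -/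
lemma tsum_mul_pow_pow_le {A q : ℝ≥0∞} {b N : ℕ} (hb : 2 ≤ b) (hq : q ^ (b ^ N) ≤ 2⁻¹)
    (hA : A * q ^ (b ^ N) ≤ 2⁻¹) : ∑' j : ℕ, A * q ^ (b ^ (j + N)) ≤ 1 := by
  have hq1 : q ≤ 1 := by
    by_contra! h
    exact absurd (hq.trans_lt (by norm_num)) (not_lt.2 (one_le_pow_of_one_le' h.le (b ^ N)))
  calc ∑' j : ℕ, A * q ^ (b ^ (j + N)) ≤ ∑' j : ℕ, 2⁻¹ * (2⁻¹ : ℝ≥0∞) ^ j := by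
        refine ENNReal.tsum_le_tsum fun j => ?_
        have h1 : b ^ N * (j + 1) ≤ b ^ (j + N) := by
          rw [pow_add, mul_comm (b ^ j)]
          exact Nat.mul_le_mul_left _ (Nat.succ_le_of_lt (Nat.lt_pow_self (show 1 < b by omega)))
        calc A * q ^ (b ^ (j + N)) ≤ A * q ^ (b ^ N * (j + 1)) := by
              gcongr 1
              exact pow_le_pow_right_of_le_one' hq1 h1
          _ = (A * q ^ (b ^ N)) * (q ^ (b ^ N)) ^ j := by
              rw [pow_mul, pow_succ']; ring
          _ ≤ _ := by gcongr
    _ = 1 := by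
        rw [ENNReal.tsum_mul_left, ENNReal.tsum_geometric]
        rw [ENNReal.one_sub_inv_two, inv_inv, ENNReal.inv_mul_cancel (by norm_num) (by norm_num)]

/-- Upper bound: the MSPRT stops in expectation by about `log log n / log (k - 1)`. -/
lemma eventually_worstRuntime_msprtTime_le (hk : 3 ≤ k) (hT : G.IsTree)
    (hReg : G.IsRegularOfDegree k) (hne : Q₀ ≠ Q₁) (h01 : Q₀ ≪ Q₁) (h10 : Q₁ ≪ Q₀)
    {Vn : ℕ → Finset V} (hcard : ∀ n, (Vn n).card = n) (R : ℕ → ℕ) {α ε : ℝ} (hα : 0 < α)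
    (hα1 : α < 1) (hε : 0 < ε) :
    ∀ᶠ n in atTop, worstRuntime G Q₀ Q₁ (Vn n) (msprtTime G Q₀ Q₁ (Vn n) (R n) α)
      ≤ ENNReal.ofReal ((1 + ε) * (Real.log (Real.log (n : ℝ)) / Real.log ((k : ℝ) - 1))) := by
  have hkb : ((k - 1 : ℕ) : ℝ) = (k : ℝ) - 1 := by rw [Nat.cast_sub (by omega)]; simp
  have hb : 1 < (k : ℝ) - 1 := by
    have : (3 : ℝ) ≤ k := by exact_mod_cast hk
    linarith
  have hlb : 0 < Real.log ((k : ℝ) - 1) := Real.log_pos hb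
  -- Replacing the affinity by a slightly larger number below one gives a real `ρ` in `(0, 1)`,
  -- whose logarithm is finite and negative.
  obtain ⟨r, hr1, hr2⟩ := exists_between
    (max_lt (affinity_lt_one h10 h01 hne.symm) (show (2⁻¹ : ℝ≥0∞) < 1 by norm_num))
  have hrt : r ≠ ∞ := (hr2.trans ENNReal.one_lt_top).ne
  set ρ := r.toReal with hρ
  have hrρ : r = ENNReal.ofReal ρ := (ENNReal.ofReal_toReal hrt).symm
  have hρ0 : 0 < ρ := ENNReal.toReal_pos (bot_le.trans_lt hr1).ne' hrt
  have hρ1 : ρ < 1 := by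
    rw [hρ, ← ENNReal.toReal_one]; exact (ENNReal.toReal_lt_toReal hrt (by simp)).2 hr2
  have hc : 0 < -Real.log ρ := neg_pos.2 (Real.log_neg hρ0 hρ1)
  have hLL : Tendsto (fun n : ℕ => Real.log (Real.log n) / Real.log ((k : ℝ) - 1)) atTop atTop :=
    (Real.tendsto_log_atTop.comp tendsto_log_natCast).atTop_div_const hlb
  filter_upwards [tendsto_log_natCast.eventually
      (eventually_sub_rpow_le hc (half_pos hε) (Real.log α)),
    tendsto_log_natCast.eventually_gt_atTop 0, eventually_ge_atTop 1,
    hLL.eventually_ge_atTop (2 / (ε / 2)), hLL.eventually_ge_atTop 0] with n h1 h2 h3 h4 h5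
  set x := Real.log (n : ℝ) with hx
  set Ln := Real.log x / Real.log ((k : ℝ) - 1) with hLn
  -- Half of `ε` makes `(k - 1) ^ N` exceed `(log n) ^ (1 + ε / 2)`; the other half, worth at least
  -- `2` by `h4`, pays for the rounding and for the tail sum.
  set N := ⌈(1 + ε / 2) * Ln⌉₊ with hN
  have hn0 : (0 : ℝ) < n := by exact_mod_cast h3
  have hn1 : (1 : ℝ) ≤ n := by exact_mod_cast h3
  have hpow : x ^ (1 + ε / 2) ≤ ((k - 1 : ℕ) : ℝ) ^ N := by
    rw [← rpow_mul_log_div_log hb h2, hkb, ← Real.rpow_natCast]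
    exact Real.rpow_le_rpow_of_exponent_le hb.le (Nat.le_ceil _)
  have hreal : (n : ℝ) * Real.exp (Real.log (n / α) / 2) * ρ ^ ((k - 1) ^ N) ≤ 2⁻¹ := by
    have e1 : (n : ℝ) = Real.exp x := (Real.exp_log hn0).symm
    have e2 : ρ ^ ((k - 1) ^ N) = Real.exp (Real.log ρ * ((k - 1 : ℕ) : ℝ) ^ N) := by
      rw [← Real.rpow_natCast, Real.rpow_def_of_pos hρ0]; push_cast; rfl
    have e3 : Real.log (n / α) = x - Real.log α := Real.log_div hn0.ne' hα.ne'
    rw [e2, e3, e1, ← Real.exp_add, ← Real.exp_add,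
      show (2⁻¹ : ℝ) = Real.exp (-Real.log 2) by rw [Real.exp_neg, Real.exp_log (by norm_num)]]
    refine Real.exp_le_exp.2 (le_trans ?_ h1)
    have := mul_le_mul_of_nonneg_left hpow hc.le
    linarith
  have hexp1 : 1 ≤ Real.exp (Real.log (n / α) / 2) := by
    refine Real.one_le_exp (div_nonneg (Real.log_nonneg ?_) (by norm_num))
    rw [le_div_iff₀ hα]; linarith
  have hpow0 : 0 ≤ ρ ^ ((k - 1) ^ N) := by positivity
  have haff : affinity Q₁ Q₀ ^ ((k - 1) ^ N) ≤ ENNReal.ofReal (ρ ^ ((k - 1) ^ N)) := by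
    rw [ENNReal.ofReal_pow hρ0.le, ← hrρ]
    gcongr
    exact (le_max_left _ _).trans hr1.le
  have h2inv : ENNReal.ofReal 2⁻¹ = 2⁻¹ := by
    rw [ENNReal.ofReal_inv_of_pos (by norm_num)]; simp
  have hsum := tsum_mul_pow_pow_le (A := n * ENNReal.ofReal (Real.exp (Real.log (n / α) / 2)))
    (q := affinity Q₁ Q₀) (b := k - 1) (N := N) (by omega)
    (by
      refine haff.trans ?_
      rw [← h2inv]
      refine ENNReal.ofReal_le_ofReal (le_trans ?_ hreal)
      exact le_mul_of_one_le_left hpow0 (one_le_mul_of_one_le_of_one_le hn1 hexp1))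
    (by
      refine (mul_le_mul_right haff _).trans ?_
      rw [← ENNReal.ofReal_natCast, ← ENNReal.ofReal_mul (Nat.cast_nonneg n),
        ← ENNReal.ofReal_mul (by positivity), ← h2inv]
      exact ENNReal.ofReal_le_ofReal hreal)
  refine (worstRuntime_msprtTime_le hT h01 h10 hReg N).trans ?_
  simp_rw [hcard n, ← mul_assoc]
  refine (add_le_add_right hsum _).trans ?_
  rw [← ENNReal.ofReal_natCast, ← ENNReal.ofReal_one,
    ← ENNReal.ofReal_add (Nat.cast_nonneg _) zero_le_one]
  refine ENNReal.ofReal_le_ofReal ?_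
  have h6 : (N : ℝ) < (1 + ε / 2) * Ln + 1 := Nat.ceil_lt_add_one (by positivity)
  rw [div_le_iff₀ (half_pos hε)] at h4
  linarith

/-- Lower bound: no admissible estimator can be faster in the worst case. -/
lemma eventually_le_optRuntime (hk : 3 ≤ k) (hc : G.Connected)
    (hReg : G.IsRegularOfDegree k) (h01 : Q₀ ≪ Q₁) (h10 : Q₁ ≪ Q₀)
    (hKL01 : InformationTheory.klDiv Q₀ Q₁ ≠ ∞) (hKL10 : InformationTheory.klDiv Q₁ Q₀ ≠ ∞)
    {Vn : ℕ → Finset V} (hcard : ∀ n, (Vn n).card = n) {R : ℕ → ℕ}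
    (hR : (fun n => (R n : ℝ)) =o[atTop] (fun n => Real.log (n : ℝ))) {α ε : ℝ} (hα : 0 < α)
    (hε : 0 < ε) (hαε : α + ε < 1) :
    ∀ᶠ n : ℕ in atTop, ENNReal.ofReal ((1 - ε) * (1 - (α + ε))
        * (Real.log (Real.log (n : ℝ)) / Real.log ((k : ℝ) - 1)))
      ≤ optRuntime G Q₀ Q₁ (Vn n) (R n) α := by
  have hkb : ((k - 1 : ℕ) : ℝ) = (k : ℝ) - 1 := by rw [Nat.cast_sub (by omega)]; simp
  have hb : 1 < (k : ℝ) - 1 := by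
    have : (3 : ℝ) ≤ k := by exact_mod_cast hk
    linarith
  have hlb : 0 < Real.log ((k : ℝ) - 1) := Real.log_pos hb
  set b : ℝ := (k : ℝ) - 1 with hbdef
  set K := ∫⁻ x, ‖llr Q₁ Q₀ x‖ₑ ∂Q₁ + ∫⁻ x, ‖llr Q₀ Q₁ x‖ₑ ∂Q₀ with hK
  have hKt : K ≠ ∞ := ENNReal.add_ne_top.2
    ⟨(InformationTheory.klDiv_ne_top_iff.1 hKL10).2.2.ne,
      (InformationTheory.klDiv_ne_top_iff.1 hKL01).2.2.ne⟩
  have hKr : K = ENNReal.ofReal K.toReal := (ENNReal.ofReal_toReal hKt).symm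
  have hK0 : 0 ≤ K.toReal := ENNReal.toReal_nonneg
  have hLL : Tendsto (fun n : ℕ => Real.log (Real.log n) / Real.log b) atTop atTop :=
    (Real.tendsto_log_atTop.comp tendsto_log_natCast).atTop_div_const hlb
  -- This constant yields `b ^ R ≤ n ^ (1/4)` and `b ^ (2R) ≤ n ^ (1/2)`, enough for the ball count
  -- and for the existence of a far `u`.
  have hR' := hR.bound (show 0 < 1 / (4 * Real.log b) by positivity)
  filter_upwards [tendsto_log_natCast.eventually
      (eventually_log_mul_rpow_le hε (Real.log b) (4 * k * b * K.toReal) (half_pos hε)),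
    tendsto_log_natCast.eventually
      (eventually_mul_exp_neg_le (k * b * α) (show (0 : ℝ) < 1 / 4 by norm_num) (half_pos hε)),
    tendsto_log_natCast.eventually
      (eventually_mul_exp_neg_le (k * b) (show (0 : ℝ) < 1 / 2 by norm_num)
        (show (0 : ℝ) < 1 / 2 by norm_num)),
    tendsto_log_natCast.eventually_gt_atTop 0, eventually_ge_atTop 1,
    hLL.eventually_ge_atTop 0, hR'] with n h1 h2 h3 h4 h5 h6 h7
  set x := Real.log (n : ℝ) with hx
  set Ln := Real.log x / Real.log b with hLn
  set t := ⌊(1 - ε) * Ln⌋₊ with ht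
  have hn0 : (0 : ℝ) < n := by exact_mod_cast h5
  have hnexp : (n : ℝ) = Real.exp x := (Real.exp_log hn0).symm
  have hRlog : (R n : ℝ) * Real.log b ≤ x / 4 := by
    rw [Real.norm_of_nonneg (Nat.cast_nonneg _), Real.norm_of_nonneg h4.le] at h7
    calc (R n : ℝ) * Real.log b ≤ 1 / (4 * Real.log b) * x * Real.log b := by gcongr
      _ = x / 4 := by field_simp
  have hbexp : ∀ m : ℕ, b ^ m = Real.exp (m * Real.log b) := fun m => by
    rw [← Real.rpow_natCast, Real.rpow_def_of_pos (by linarith), mul_comm]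
  have hbR : b ^ (R n) ≤ Real.exp (x / 4) := by
    rw [hbexp]; exact Real.exp_le_exp.2 hRlog
  have hb2R : b ^ (2 * R n) ≤ Real.exp (x / 2) := by
    rw [hbexp]; refine Real.exp_le_exp.2 ?_; push_cast; linarith
  have hbt : b ^ t ≤ x ^ (1 - ε) := by
    rw [← rpow_mul_log_div_log hb h4, ← Real.rpow_natCast]
    exact Real.rpow_le_rpow_of_exponent_le hb.le
      (Nat.floor_le (mul_nonneg (by linarith) h6))
  have htL : (t : ℝ) ≤ Ln := (Nat.floor_le (mul_nonneg (by linarith) h6)).trans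
    (mul_le_of_le_one_left h6 (by linarith))
  -- Not having stopped by `t` means `T ≥ t + 1`, so rounding `t` down costs nothing.
  have htL' : (1 - ε) * Ln ≤ (t + 1 : ℕ) := by push_cast; exact (Nat.lt_floor_add_one _).le
  obtain ⟨v, hv⟩ : (Vn n).Nonempty := Finset.card_pos.1 (by rw [hcard n]; omega)
  obtain ⟨u, hu, hd⟩ := exists_far (W := Vn n) hc hk hReg v (2 * R n) (by
    rw [hcard n]
    have : (k : ℝ) * b ^ (2 * R n + 1) < n := by
      calc (k : ℝ) * b ^ (2 * R n + 1) = k * b * b ^ (2 * R n) := by ring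
        _ ≤ k * b * Real.exp (x / 2) := by gcongr
        _ = (k * b * Real.exp (-(1 / 2 * x))) * n := by
            rw [hnexp, mul_assoc _ (Real.exp _) (Real.exp _), ← Real.exp_add]; congr 2; ring
        _ ≤ 1 / 2 * n := by gcongr
        _ < n := by linarith
    rw [← hkb] at this
    exact_mod_cast this)
  refine le_iInf₂ fun E hE => ?_
  -- The threshold `c = x / 2` balances the errors: Markov's term is of order `x ^ (-ε) * log x`,
  -- and the change of measure gives `n ^ (1/2) * n ^ (1/4) / n = n ^ (-1/4)` up to constants.
  have hP : sourceLaw G Q₀ Q₁ v {ω | E.T ω ≤ (t : ℕ∞)} ≤ ENNReal.ofReal (α + ε) := by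
    refine (sourceLaw_le_time_le hc h01 h10 hE hv hu hd t (x / 2)).trans ?_
    rw [hcard n, show α + ε = α + ε / 2 + ε / 2 by ring,
      ENNReal.ofReal_add (by positivity) (by positivity),
      ENNReal.ofReal_add (by positivity) (by positivity)]
    refine add_le_add (add_le_add (le_of_eq ?_) ?_) ?_
    · rw [← ENNReal.ofReal_natCast, ← ENNReal.ofReal_mul hn0.le, mul_div_cancel₀ _ hn0.ne']
    · refine (sourceLaw_lt_cumLLR_le hc h01 h10 hk hReg v u t (half_pos h4)).trans ?_
      rw [← hK, hKr, ← ENNReal.ofReal_natCast, ← ENNReal.ofReal_mul (Nat.cast_nonneg _),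
        ← ENNReal.ofReal_div_of_pos (half_pos h4)]
      refine ENNReal.ofReal_le_ofReal (le_trans ?_ h1)
      push_cast
      rw [hkb]
      calc ((t : ℝ) + 1) * (2 * (k * b ^ (t + 1))) * K.toReal / (x / 2)
          = (t + 1) * (4 * k * b * K.toReal) * (b ^ t / x) := by field_simp; ring
        _ ≤ (Ln + 1) * (4 * k * b * K.toReal) * (x ^ (1 - ε) / x) := by gcongr
        _ = (Ln + 1) * (4 * k * b * K.toReal) * x ^ (-ε) := by
            rw [← Real.rpow_sub_one h4.ne']; congr 2; ring
    · have hball : ((ballFinset G v (R n)).card : ℝ) ≤ k * b * Real.exp (x / 4) := by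
        calc ((ballFinset G v (R n)).card : ℝ) ≤ (k * (k - 1) ^ (R n + 1) : ℕ) := by
              exact_mod_cast card_ballFinset_le hc hk hReg v (R n)
          _ = k * b * b ^ (R n) := by push_cast; rw [hkb]; ring
          _ ≤ _ := by gcongr
      rw [← ENNReal.ofReal_natCast, ← ENNReal.ofReal_mul (Nat.cast_nonneg _),
        ← ENNReal.ofReal_mul (Real.exp_pos _).le]
      refine ENNReal.ofReal_le_ofReal (le_trans ?_ h2)
      calc Real.exp (x / 2) * ((ballFinset G v (R n)).card * (α / n))
          ≤ Real.exp (x / 2) * (k * b * Real.exp (x / 4) * (α / n)) := by gcongr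
        _ = k * b * α * (Real.exp (x / 2) * Real.exp (x / 4) * Real.exp (-x)) := by
            rw [hnexp, Real.exp_neg]; ring
        _ = k * b * α * Real.exp (-(1 / 4 * x)) := by
            rw [← Real.exp_add, ← Real.exp_add]; congr 2; ring
  have hmeas : MeasurableSet {ω | E.T ω ≤ (t : ℕ∞)} :=
    (Filtration.piLE (X := fun _ : ℕ => V → ℝ)).le t _ (E.T_stopping t)
  have hPc : ENNReal.ofReal (1 - (α + ε))
      ≤ sourceLaw G Q₀ Q₁ v {ω | E.T ω ≤ (t : ℕ∞)}ᶜ := by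
    rw [prob_compl_eq_one_sub hmeas, ENNReal.ofReal_sub _ (by positivity), ENNReal.ofReal_one]
    gcongr
  calc ENNReal.ofReal ((1 - ε) * (1 - (α + ε)) * Ln)
      = ENNReal.ofReal ((1 - ε) * Ln) * ENNReal.ofReal (1 - (α + ε)) := by
        rw [← ENNReal.ofReal_mul (mul_nonneg (by linarith) h6)]; congr 1; ring
    _ ≤ ((t + 1 : ℕ) : ℝ≥0∞) * sourceLaw G Q₀ Q₁ v {ω | E.T ω ≤ (t : ℕ∞)}ᶜ := by
        rw [← ENNReal.ofReal_natCast]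
        gcongr
    _ = ∫⁻ ω, ({ω | E.T ω ≤ (t : ℕ∞)}ᶜ : Set (Obs V)).indicator
          (fun _ => ((t + 1 : ℕ) : ℝ≥0∞)) ω ∂sourceLaw G Q₀ Q₁ v :=
        (lintegral_indicator_const hmeas.compl _).symm
    _ ≤ ∫⁻ ω, (E.T ω : ℝ≥0∞) ∂sourceLaw G Q₀ Q₁ v := by
        refine lintegral_mono fun ω => Set.indicator_apply_le' (fun hω => ?_) fun _ => zero_le
        have h8 : (t : ℕ∞) < E.T ω := by simpa using hω
        have h9 : ((t + 1 : ℕ) : ℕ∞) ≤ E.T ω := by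
          push_cast; exact Order.add_one_le_of_lt h8
        simpa using ENat.toENNReal_le.2 h9
    _ ≤ worstRuntime G Q₀ Q₁ (Vn n) E.T :=
        le_iSup₂ (f := fun v _ => ∫⁻ ω, (E.T ω : ℝ≥0∞) ∂sourceLaw G Q₀ Q₁ v) v hv

end Runtime

end Cascade

theorem corollary1 {V : Type*} (G : SimpleGraph V) [G.LocallyFinite] (k : ℕ) (hk : 3 ≤ k)
    (hTree : G.IsTree) (hReg : G.IsRegularOfDegree k)
    (Q₀ Q₁ : Measure ℝ) [IsProbabilityMeasure Q₀] [IsProbabilityMeasure Q₁]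
    (hne : Q₀ ≠ Q₁) (h01 : Q₀ ≪ Q₁) (h10 : Q₁ ≪ Q₀)
    (hKL01 : InformationTheory.klDiv Q₀ Q₁ ≠ ∞) (hKL10 : InformationTheory.klDiv Q₁ Q₀ ≠ ∞)
    (Vn : ℕ → Finset V) (hcard : ∀ n, (Vn n).card = n)
    (R : ℕ → ℕ)
    (hR : (fun n => (R n : ℝ)) =o[atTop] (fun n => Real.log (n : ℝ))) :
    -- for every size and error level there is an MSPRT, and every MSPRT lies in the class `Δ_G`
    (∀ n : ℕ, 1 ≤ n → ∀ α : ℝ, 0 < α → α < 1 →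
      (∃ E : Cascade.SequentialEstimator (Vn n), Cascade.IsMSPRT G Q₀ Q₁ (Vn n) (R n) α E) ∧
      (∀ E : Cascade.SequentialEstimator (Vn n), Cascade.IsMSPRT G Q₀ Q₁ (Vn n) (R n) α E →
        E ∈ Cascade.admissible G Q₀ Q₁ (Vn n) (R n) α)) ∧
    -- the worst-case expected runtime of the MSPRT is asymptotically the optimal one
    Cascade.AsympEq
      (fun n α => Cascade.worstRuntime G Q₀ Q₁ (Vn n) (Cascade.msprtTime G Q₀ Q₁ (Vn n) (R n) α))
      (fun n α => Cascade.optRuntime G Q₀ Q₁ (Vn n) (R n) α) ∧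
    -- the optimal worst-case expected runtime is asymptotically `log log n / log (k - 1)`
    Cascade.AsympEq
      (fun n α => Cascade.optRuntime G Q₀ Q₁ (Vn n) (R n) α)
      (fun n _ => ENNReal.ofReal (Real.log (Real.log (n : ℝ)) / Real.log ((k : ℝ) - 1))) := by
  have hc := hTree.connected
  have hb : 1 < (k : ℝ) - 1 := by
    have : (3 : ℝ) ≤ k := by exact_mod_cast hk
    linarith
  have hW : ∀ n, 1 ≤ n → (Vn n).Nonempty := fun n hn =>
    Finset.card_pos.1 (by rw [hcard n]; omega)
  refine ⟨fun n hn α hα _ => ⟨Cascade.exists_isMSPRT (hW n hn), fun E hE =>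
    hE.mem_admissible hc h01 h10 hα⟩, ?_⟩
  refine Cascade.asympEq_of_bounds ?_ ?_ ?_ ?_
  · exact ((Real.tendsto_log_atTop.comp Cascade.tendsto_log_natCast).atTop_div_const
      (Real.log_pos hb)).eventually_gt_atTop 0
  · intro α hα
    filter_upwards [eventually_ge_atTop 1] with n hn
    exact Cascade.optRuntime_le_worstRuntime_msprtTime hc h01 h10 hα (hW n hn)
  · intro α hα hα1
    exact Cascade.eventually_worstRuntime_msprtTime_le hk hTree hReg hne h01 h10 hcard R hα
      (by linarith) hα
  · intro α hα hα1
    have h := Cascade.eventually_le_optRuntime hk hc hReg h01 h10 hKL01 hKL10 hcard hR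
      hα hα (by linarith)
    rwa [← two_mul] at h
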